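/- **Conventions.** Let $F_3$ be the free group of rank $3$ and $\operatorname{Out}(F_3)=\operatorname{Aut}(F_3)/\operatorname{Inn}(F_3)$. Let $\Gamma$ be a finite connected graph (loops and multiple edges allowed) with a marking, i.e. a homotopy equivalence from the rose with three petals to $\Gamma$, which up to homotopy is a base vertex $v$ together with an isomorphism $F_3\cong\pi_1(\Gamma,v)$. A *topological representative* of $\Phi\in\operatorname{Out}(F_3)$ is a map $f:\Gamma\to\Gamma$ that sends vertices to vertices, sends each edge to a nontrivial reduced (immersed) edge path, and induces $\Phi$ on $\pi_1(\Gamma)\cong F_3$. (In particular, $f$ is a homotopy equivalence.) A *filtration* is a strictly increasing chain $\emptyset=G_0\subset G_1\subset\dots\subset G_m=\Gamma$ of (not necessarily connected) $f$-invariant subgraphs; the $r$-th *stratum* $H_r$ is the closure of $G_r\setminus G_{r-1}$. The *transition matrix* $M_r$ is indexed by the edges of $H_r$; its $(a,b)$ entry is the number of times that $f(b)$ crosses $a$ in either direction. The stratum $H_r$ is *exponential* if $M_r$ is irreducible with Perron–Frobenius eigenvalue larger than $1$. For an oriented edge $d$ let $Df(d)$ be the first oriented edge of $f(d)$. A *turn*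 is an unordered pair $\{d,d'\}$ of oriented edges with the same initial vertex; it is *legal* if $(Df)^k(d)\neq (Df)^k(d')$ for all $k\ge 0$. An edge path $d_1\cdots d_l$ crosses the turns $\{\bar d_i,d_{i+1}\}$, where $\bar d$ is the reverse of $d$; it is *legal* if all these turns are legal. A path in $G_r$ is *$r$-legal* if every turn that it crosses and whose two directions both lie in $H_r$ is legal. The map $f$, with the filtration, is a *relative train track map* if every $M_r$ is zero or irreducible and for every exponential stratum $H_r$: 1. $Df$ maps oriented edges of $H_r$ to oriented edges of $H_r$; 2. if $\beta$ is a nontrivial reduced path in $G_{r-1}$ with both endpoints in $H_r\cap G_{r-1}$, then the path obtained by tightening $f(\beta)$ is nontrivial; 3. if $\sigma$ is a legal path in $H_r$, then $f(\sigma)$ is an $r$-legal path in $G_r$. **Proposition.** Let $\Phi\in\operatorname{Out}(F_3)$. Then every relative train track representative $f:\Gamma\to\Gamma$ of $\Phi$ has at most one exponential stratum. -/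

import Mathlib

/-- The inner automorphisms form a normal subgroup of the automorphism group. -/
instance innerAutomorphisms_normal (G : Type*) [Group G] :
    (MulAut.conj : G →* MulAut G).range.Normal where
  conj_mem := by
    rintro _ ⟨g, rfl⟩ φ
    refine ⟨φ g, ?_⟩
    ext x
    simp [MulAut.conj_apply]

/-- The outer automorphism group `Out(G) = Aut(G) / Inn(G)`. -/
abbrev OuterAut (G : Type*) [Group G] : Type _ :=
  MulAut G ⧸ (MulAut.conj : G →* MulAut G).range

/-- A graph (one-dimensional cell complex) with vertex set `V` and edge set `E`; every edge carries
an arbitrarily chosen orientation. Loops and multiple edges are allowed.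

An oriented edge is an element of `E × Bool`: `(e, true)` is `e` with the chosen orientation and
`(e, false)` is `e` with the opposite orientation. -/
structure CellGraph (V E : Type*) where
  /-- initial vertex of an edge -/
  src : E → V
  /-- terminal vertex of an edge -/
  tgt : E → V

namespace CellGraph

/-- The reverse of an oriented edge. -/
def flip {E : Type*} (d : E × Bool) : E × Bool := (d.1, !d.2)

/-- The initial vertex of an oriented edge. -/
def init {V E : Type*} (Γ : CellGraph V E) (d : E × Bool) : V :=
  if d.2 then Γ.src d.1 else Γ.tgt d.1

/-- The terminal vertex of an oriented edge. -/
def term {V E : Type*} (Γ : CellGraph V E) (d : E × Bool) : V :=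
  if d.2 then Γ.tgt d.1 else Γ.src d.1

/-- The word `w` in oriented edges is an edge path from `u` to `v` (not necessarily reduced,
possibly empty). -/
def IsPath {V E : Type*} (Γ : CellGraph V E) : V → V → List (E × Bool) → Prop
  | u, v, [] => u = v
  | u, v, d :: w => Γ.init d = u ∧ Γ.IsPath (Γ.term d) v w

/-- Any two vertices are joined by an edge path. -/
def Connected {V E : Type*} (Γ : CellGraph V E) : Prop :=
  ∀ u v : V, ∃ w : List (E × Bool), Γ.IsPath u v w

theorem IsPath.append {V E : Type*} {Γ : CellGraph V E} {u v x : V} {w w' : List (E × Bool)}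
    (h : Γ.IsPath u v w) (h' : Γ.IsPath v x w') : Γ.IsPath u x (w ++ w') := by
  induction w generalizing u with
  | nil => cases h; exact h'
  | cons d w ih => exact ⟨h.1, ih h.2⟩

theorem IsPath.invRev {V E : Type*} {Γ : CellGraph V E} {u v : V} {w : List (E × Bool)}
    (h : Γ.IsPath u v w) : Γ.IsPath v u (FreeGroup.invRev w) := by
  induction w generalizing u with
  | nil => cases h; rfl
  | cons d w ih =>
    rw [FreeGroup.invRev_cons]
    refine (ih h.2).append ?_
    obtain ⟨e, b⟩ := d
    have h1 := h.1
    cases b <;> exact ⟨by simp [init, term], by simpa [init, term, IsPath] using h1⟩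

/-- The fundamental group `π₁(Γ, v)`. Two edge paths with the same endpoints are homotopic relative
to their endpoints if and only if they have the same free reduction, that is, if and only if they
define the same element of the free group on the edge set. Therefore the group of homotopy classes
of closed edge paths at `v` is the following subgroup of the free group on the edge set. -/
def fundamentalGroup {V E : Type*} (Γ : CellGraph V E) (v : V) : Subgroup (FreeGroup E) where
  carrier := {g | ∃ w : List (E × Bool), Γ.IsPath v v w ∧ FreeGroup.mk w = g}
  one_mem' := ⟨[], rfl, rfl⟩
  mul_mem' := by
    rintro _ _ ⟨w, hw, rfl⟩ ⟨w', hw', rfl⟩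
    exact ⟨w ++ w', hw.append hw', FreeGroup.mul_mk.symm⟩
  inv_mem' := by
    rintro _ ⟨w, hw, rfl⟩
    exact ⟨FreeGroup.invRev w, hw.invRev, FreeGroup.inv_mk.symm⟩

/-- A marking of `Γ` by the free group of rank `n`, i.e. a homotopy equivalence (up to homotopy)
from the rose with `n` petals to `Γ`, recorded through the image of the vertex of the rose and the
induced isomorphism of fundamental groups. -/
structure Marking {V E : Type*} (Γ : CellGraph V E) (n : ℕ) where
  /-- the image of the vertex of the rose -/
  base : V
  /-- the induced isomorphism of fundamental groups -/
  iso : FreeGroup (Fin n) ≃* Γ.fundamentalGroup base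

/-- A map `f : Γ → Γ` which maps vertices to vertices and edges to nontrivial immersed (that is,
reduced) edge paths. -/
structure EdgePathMap {V E : Type*} (Γ : CellGraph V E) where
  /-- the image of a vertex -/
  vert : V → V
  /-- the image of an edge, with its chosen orientation -/
  edge : E → List (E × Bool)
  isPath : ∀ e, Γ.IsPath (vert (Γ.src e)) (vert (Γ.tgt e)) (edge e)
  edge_ne_nil : ∀ e, edge e ≠ []
  reduced : ∀ e, FreeGroup.IsReduced (edge e)

namespace EdgePathMap

/-- The image of an oriented edge. -/
def oriented {V E : Type*} {Γ : CellGraph V E} (f : Γ.EdgePathMap) (d : E × Bool) :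
    List (E × Bool) :=
  if d.2 then f.edge d.1 else FreeGroup.invRev (f.edge d.1)

theorem oriented_ne_nil {V E : Type*} {Γ : CellGraph V E} (f : Γ.EdgePathMap) (d : E × Bool) :
    f.oriented d ≠ [] := by
  obtain ⟨e, b⟩ := d
  have h := f.edge_ne_nil e
  cases b <;> simpa [oriented, FreeGroup.invRev] using h

/-- The image `f(w)` of an edge path; it is not tightened. -/
def path {V E : Type*} {Γ : CellGraph V E} (f : Γ.EdgePathMap) (w : List (E × Bool)) :
    List (E × Bool) :=
  w.flatMap f.oriented

/-- The map induced by `f` on homotopy classes of edge paths, extended to the free group on the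
edge set. -/
def onFreeGroup {V E : Type*} {Γ : CellGraph V E} (f : Γ.EdgePathMap) :
    FreeGroup E →* FreeGroup E :=
  FreeGroup.lift fun e => FreeGroup.mk (f.edge e)

/-- `f` represents the outer automorphism `Φ` with respect to the marking `τ`: there are an
automorphism `φ` in the class `Φ` and a path `η` from the base point `v` to `f(v)` such that `φ`
corresponds under the marking to the endomorphism `γ ↦ [η f(γ) η⁻¹]` of `π₁(Γ, v)`. In particular
(for connected `Γ`) `f` is a homotopy equivalence. -/
def Represents {V E : Type*} {Γ : CellGraph V E} (f : Γ.EdgePathMap) {n : ℕ} (τ : Γ.Marking n)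
    (Φ : OuterAut (FreeGroup (Fin n))) : Prop :=
  ∃ φ : MulAut (FreeGroup (Fin n)), (φ : OuterAut (FreeGroup (Fin n))) = Φ ∧
    ∃ η : List (E × Bool), Γ.IsPath τ.base (f.vert τ.base) η ∧
      ∀ x : FreeGroup (Fin n),
        (τ.iso (φ x) : FreeGroup E) =
          FreeGroup.mk η * f.onFreeGroup (τ.iso x : FreeGroup E) * (FreeGroup.mk η)⁻¹

/-- The map `Df` on directions (oriented edges): `Df(d)` is the first oriented edge of `f(d)`. -/
def direction {V E : Type*} {Γ : CellGraph V E} (f : Γ.EdgePathMap) (d : E × Bool) : E × Bool :=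
  (f.oriented d).head (f.oriented_ne_nil d)

/-- The turn `{d, d'}` (a pair of oriented edges with the same initial vertex) is legal: no iterate
of `Df` makes it degenerate. -/
def LegalTurn {V E : Type*} {Γ : CellGraph V E} (f : Γ.EdgePathMap) (d d' : E × Bool) : Prop :=
  ∀ k : ℕ, f.direction^[k] d ≠ f.direction^[k] d'

/-- Every turn crossed by the path `w` is legal. -/
def LegalPath {V E : Type*} {Γ : CellGraph V E} (f : Γ.EdgePathMap) (w : List (E × Bool)) : Prop :=
  w.IsChain fun d d' => f.LegalTurn (flip d) d'

/-- A filtration `∅ = G_0 ⊂ G_1 ⊂ ⋯ ⊂ G_m = Γ` by `f`-invariant subgraphs. A subgraph is given by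
its set of edges. -/
structure Filtration {V E : Type*} {Γ : CellGraph V E} (f : Γ.EdgePathMap) where
  /-- the number `m` of strata -/
  len : ℕ
  /-- the edges of `G_i` -/
  sub : Fin (len + 1) → Set E
  sub_zero : sub 0 = ∅
  sub_last : sub (Fin.last len) = Set.univ
  strictMono : StrictMono sub
  invariant : ∀ i, ∀ e ∈ sub i, ∀ d ∈ f.edge e, d.1 ∈ sub i

namespace Filtration

/-- The edges of a stratum. The index `i : Fin m` stands for the stratum number `i + 1`, which is
the closure of the difference of `G_{i+1}` and `G_i`. -/
def stratum {V E : Type*} {Γ : CellGraph V E} {f : Γ.EdgePathMap} (F : f.Filtration)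
    (i : Fin F.len) : Set E :=
  F.sub i.succ \ F.sub i.castSucc

open Classical in
/-- The transition matrix of a stratum: the entry at `(a, b)` is the number of times that the path
`f(b)` crosses the edge `a`, in either direction. -/
noncomputable def transitionMatrix {V E : Type*} {Γ : CellGraph V E} {f : Γ.EdgePathMap}
    (F : f.Filtration) (i : Fin F.len) : Matrix (F.stratum i) (F.stratum i) ℝ :=
  Matrix.of fun a b => (((f.edge b).map Prod.fst).count (a : E) : ℝ)

open Classical in
/-- A stratum is exponentially growing if its transition matrix is irreducible and its
Perron–Frobenius eigenvalue (the eigenvalue of a positive eigenvector) is larger than `1`. -/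
def IsExponential {V E : Type*} [Fintype E] {Γ : CellGraph V E} {f : Γ.EdgePathMap}
    (F : f.Filtration) (i : Fin F.len) : Prop :=
  (F.transitionMatrix i).IsIrreducible ∧
    ∃ (lam : ℝ) (x : F.stratum i → ℝ), 1 < lam ∧ (∀ a, 0 < x a) ∧
      (F.transitionMatrix i).mulVec x = lam • x

/-- The vertex `v` is an endpoint of an edge of the given stratum. -/
def IsVertexOf {V E : Type*} {Γ : CellGraph V E} {f : Γ.EdgePathMap} (F : f.Filtration)
    (i : Fin F.len) (v : V) : Prop :=
  ∃ e ∈ F.stratum i, Γ.src e = v ∨ Γ.tgt e = v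

/-- The path `w` lies in the subgraph `G_{i+1}`, and every turn that it crosses and whose two
directions both lie in the stratum with index `i` is legal. -/
def StratumLegal {V E : Type*} {Γ : CellGraph V E} {f : Γ.EdgePathMap} (F : f.Filtration)
    (i : Fin F.len) (w : List (E × Bool)) : Prop :=
  (∀ d ∈ w, d.1 ∈ F.sub i.succ) ∧
    w.IsChain fun d d' => d.1 ∈ F.stratum i → d'.1 ∈ F.stratum i → f.LegalTurn (flip d) d'

/-- `f`, with the given filtration, is a relative train track map. -/
structure IsRelativeTrainTrack {V E : Type*} [Fintype E] {Γ : CellGraph V E} {f : Γ.EdgePathMap}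
    (F : f.Filtration) : Prop where
  /-- Every transition matrix is zero or irreducible. -/
  zero_or_irreducible : ∀ i, F.transitionMatrix i = 0 ∨ (F.transitionMatrix i).IsIrreducible
  /-- `Df` maps the directions in an exponential stratum to directions in that stratum. -/
  direction_mem : ∀ i, F.IsExponential i →
    ∀ d : E × Bool, d.1 ∈ F.stratum i → (f.direction d).1 ∈ F.stratum i
  /-- Let `β` be a nontrivial (reduced) path in the subgraph just below an exponential stratum, with
  endpoints in that stratum. Then the path obtained by tightening `f(β)` is nontrivial. -/
  connecting_path : ∀ i, F.IsExponential i →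
    ∀ (u v : V) (β : List (E × Bool)), Γ.IsPath u v β → FreeGroup.IsReduced β → β ≠ [] →
      (∀ d ∈ β, d.1 ∈ F.sub i.castSucc) → F.IsVertexOf i u → F.IsVertexOf i v →
        FreeGroup.mk (f.path β) ≠ 1
  /-- The image of a legal path in an exponential stratum crosses no illegal turn of the stratum. -/
  legal_path : ∀ i, F.IsExponential i →
    ∀ (u v : V) (σ : List (E × Bool)), Γ.IsPath u v σ → (∀ d ∈ σ, d.1 ∈ F.stratum i) →
      f.LegalPath σ → F.StratumLegal i (f.path σ)

end Filtration

end EdgePathMap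

end CellGraph

/-! ### Unique products in free groups -/

/-! Suppose that the strata `i < j` are both exponential, and let `S` be the subgraph just below
stratum `j`; it contains stratum `i`. By the train track conditions, stratum edges never cancel in
images of legal paths, so each of the two strata carries a loop whose number of stratum edges grows
without bound under iteration; the same holds uniformly for its powers (`exists_growing_loop`).

Pushing the lower loop forward by iterates of `f` makes it a loop at a vertex `v` fixed by some `f ^
m`. Let `C` be the component of `v` in `S`, and choose a spanning tree `T` of `Γ` that extends a
spanning tree of `C`. At most three edges lie outside `T` (`ncard_compl_le`), so at most one of them
lies in `C`, or at most one lies outside `C`.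

In the first case `π₁(C, v)` is trivial or infinite cyclic. Since `f` is bijective on fundamental
groups, `f ^ m` sends a generator to itself or its inverse, so the lower loop cannot grow
(`letterCount_iter_eq_of_cyclic`).

In the second case `π₁(Γ, v)` is generated by `π₁(C, v)` and at most one further element `t`. The
iterate `f ^ (m * k)` preserves `π₁(C, v)`, and the Fox chain rule makes the `t`-derivative of the
image of `t`, after retraction onto `π₁(Γ, v)`, a one-sided unit of the integral group ring of a
free group. Free groups have unique products, so this unit has a single term. The Fox derivative of
a reduced word with respect to an edge has as many terms as the word has occurrences of that edge;
hence the image of `x ^ l` crosses at most `l * W` edges outside `S`, with `W` independent of `k`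
(`exists_letterCount_iter_le`). This contradicts the growth of the upper loop. -/

theorem exists_hom_int_ne_one_of_isFreeGroup {G : Type*} [Group G] [IsFreeGroup G] (s : Set G)
    (hs : Subgroup.closure s = ⊤) (hne : ∃ x : G, x ≠ 1) :
    ∃ χ : G →* Multiplicative ℤ, ∃ x ∈ s, χ x ≠ 1 := by
  let e := IsFreeGroup.toFreeGroup G
  have hX : Nonempty (IsFreeGroup.Generators G) := by
    by_contra hX
    rw [not_nonempty_iff] at hX
    obtain ⟨x, hx⟩ := hne
    exact hx (e.injective (Subsingleton.elim _ _))
  obtain ⟨b⟩ := hX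
  -- The total exponent sum in a free basis; if it vanished on the generating set `s`, it would
  -- vanish on a basis element.
  let χ : G →* Multiplicative ℤ :=
    (FreeGroup.lift fun _ => Multiplicative.ofAdd (1 : ℤ)).comp e.toMonoidHom
  refine ⟨χ, ?_⟩
  by_contra hcon
  push Not at hcon
  have h1 : χ = 1 := MonoidHom.eq_of_eqOn_dense hs fun x hx => hcon x hx
  have h2 : χ (e.symm (FreeGroup.of b)) = 1 := by rw [h1]; rfl
  have h3 : χ (e.symm (FreeGroup.of b)) = Multiplicative.ofAdd (1 : ℤ) := by simp [χ]
  rw [h3] at h2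
  exact one_ne_zero (Multiplicative.ofAdd.injective h2)

/-- Every nontrivial finitely generated subgroup of a free group is free, hence maps nontrivially to
`ℤ`. A unique product for the slices of `A` and `B` of maximal value under such a map is one for `A`
and `B`, so induction on the total size applies. -/
instance FreeGroup.instUniqueProds {α : Type*} : UniqueProds (FreeGroup α) where
  uniqueMul_of_nonempty {A B} hA hB := by
    classical
    induction hn : A.card + B.card using Nat.strong_induction_on generalizing A B with
    | _ n ih =>
    by_cases hc : A.card ≤ 1 ∧ B.card ≤ 1
    · exact UniqueMul.of_card_le_one hA hB hc.1 hc.2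
    obtain ⟨a₀, ha₀⟩ := id hA
    obtain ⟨b₀, hb₀⟩ := id hB
    -- Translating `A` and `B` so that both contain `1` leaves unique products unaffected and puts
    -- both translates into one subgroup `H`.
    let s : Finset (FreeGroup α) := A.image (a₀⁻¹ * ·) ∪ B.image (· * b₀⁻¹)
    let H := Subgroup.closure (s : Set (FreeGroup α))
    have hAs : ∀ a ∈ A, a₀⁻¹ * a ∈ s := fun a ha =>
      Finset.mem_union_left _ (Finset.mem_image_of_mem _ ha)
    have hBs : ∀ b ∈ B, b * b₀⁻¹ ∈ s := fun b hb =>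
      Finset.mem_union_right _ (Finset.mem_image_of_mem (· * b₀⁻¹) hb)
    have hsH : ∀ x ∈ s, x ∈ H := fun x hx => Subgroup.subset_closure hx
    have hex : ∃ x ∈ s, x ≠ 1 := by
      rw [not_and_or, not_le, not_le] at hc
      rcases hc with h | h
      · obtain ⟨a, ha, hne⟩ := Finset.exists_mem_ne h a₀
        exact ⟨_, hAs a ha, fun h => hne (inv_mul_eq_one.1 h).symm⟩
      · obtain ⟨b, hb, hne⟩ := Finset.exists_mem_ne h b₀
        exact ⟨_, hBs b hb, fun h => hne (mul_inv_eq_one.1 h)⟩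
    obtain ⟨χ, ⟨x, hxH⟩, hx, hχx⟩ := exists_hom_int_ne_one_of_isFreeGroup
      (G := H) (Subtype.val ⁻¹' (s : Set (FreeGroup α)))
      (Subgroup.closure_closure_coe_preimage)
      (by obtain ⟨x, hx, hne⟩ := hex
          exact ⟨⟨x, hsH x hx⟩, fun h => hne (congrArg Subtype.val h)⟩)
    -- The value `0` outside `H` is a mere default: additivity is only used inside `H`.
    let c : FreeGroup α → ℤ := fun g => if h : g ∈ H then (χ ⟨g, h⟩).toAdd else 0
    have hc_mul : ∀ g ∈ H, ∀ h ∈ H, c (g * h) = c g + c h := by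
      intro g hg h hh
      simp only [c, dif_pos hg, dif_pos hh, dif_pos (H.mul_mem hg hh)]
      exact congrArg Multiplicative.toAdd (_root_.map_mul χ (⟨g, hg⟩ : H) (⟨h, hh⟩ : H))
    have hc_one : c 1 = 0 := by
      simpa using hc_mul 1 H.one_mem 1 H.one_mem
    have hcx : c x ≠ 0 := by
      simp only [c, dif_pos hxH]
      exact fun h => hχx (Multiplicative.toAdd.injective h)
    obtain ⟨aM, haM, hmaxA⟩ := A.exists_max_image (fun a => c (a₀⁻¹ * a)) hA
    obtain ⟨bM, hbM, hmaxB⟩ := B.exists_max_image (fun b => c (b * b₀⁻¹)) hB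
    let A' := A.filter fun a => c (a₀⁻¹ * a) = c (a₀⁻¹ * aM)
    let B' := B.filter fun b => c (b * b₀⁻¹) = c (bM * b₀⁻¹)
    -- Both translates contain `1`, of value `0`, and one of them contains `x`, of nonzero value;
    -- that one is not a single slice.
    have hlt : A'.card + B'.card < n := by
      rw [← hn]
      have hle1 : A'.card ≤ A.card := Finset.card_filter_le _ _
      have hle2 : B'.card ≤ B.card := Finset.card_filter_le _ _
      rcases Finset.mem_union.1 hx with h | h
      · obtain ⟨a, ha, rfl⟩ := Finset.mem_image.1 h
        have : A'.card < A.card := by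
          refine Finset.card_lt_card (Finset.filter_ssubset.2 ?_)
          by_contra hcon
          push Not at hcon
          have h1 := hcon a ha
          have h2 := hcon a₀ ha₀
          rw [inv_mul_cancel, hc_one] at h2
          exact hcx (h1.trans h2.symm)
        lia
      · obtain ⟨b, hb, rfl⟩ := Finset.mem_image.1 h
        have : B'.card < B.card := by
          refine Finset.card_lt_card (Finset.filter_ssubset.2 ?_)
          by_contra hcon
          push Not at hcon
          have h1 := hcon b hb
          have h2 := hcon b₀ hb₀
          rw [mul_inv_cancel, hc_one] at h2
          exact hcx (h1.trans h2.symm)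
        lia
    obtain ⟨a, ha, b, hb, hu⟩ := ih _ hlt (A := A') (B := B')
      ⟨aM, Finset.mem_filter.2 ⟨haM, rfl⟩⟩ ⟨bM, Finset.mem_filter.2 ⟨hbM, rfl⟩⟩ rfl
    obtain ⟨haA, hca⟩ := Finset.mem_filter.1 ha
    obtain ⟨hbB, hcb⟩ := Finset.mem_filter.1 hb
    refine ⟨a, haA, b, hbB, fun a' b' ha' hb' hab => ?_⟩
    have h1 := hc_mul _ (hsH _ (hAs a' ha')) _ (hsH _ (hBs b' hb'))
    have h2 := hc_mul _ (hsH _ (hAs a haA)) _ (hsH _ (hBs b hbB))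
    have h3 : a₀⁻¹ * a' * (b' * b₀⁻¹) = a₀⁻¹ * a * (b * b₀⁻¹) := by
      calc a₀⁻¹ * a' * (b' * b₀⁻¹) = a₀⁻¹ * (a' * b') * b₀⁻¹ := by group
        _ = a₀⁻¹ * a * (b * b₀⁻¹) := by rw [hab]; group
    rw [h3] at h1
    have h4 := hmaxA a' ha'
    have h5 := hmaxB b' hb'
    exact hu (Finset.mem_filter.2 ⟨ha', by lia⟩) (Finset.mem_filter.2 ⟨hb', by lia⟩) hab

/-- One-sided units of the group ring over a group with unique products are supported on one
element. -/
theorem MonoidAlgebra.exists_eq_single_of_mul_eq_one {R G : Type*} [CommRing R] [IsDomain R]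
    [Group G] [UniqueProds G] {v u : MonoidAlgebra R G} (h : v * u = 1) :
    ∃ (g : G) (r : R), u = MonoidAlgebra.single g r := by
  classical
  have := UniqueProds.toTwoUniqueProds_of_group (G := G)
  -- Otherwise two distinct pairs of support elements have unique products. No cancellation occurs
  -- there, so both products lie in the support of `1` and coincide, against uniqueness.
  have hu : u.coeff.support.card ≤ 1 := by
    by_contra hcon
    have hv0 : v.coeff.support.Nonempty := by
      rw [Finset.nonempty_iff_ne_empty, Ne, Finsupp.support_eq_empty]
      intro h0
      have : v = 0 := by ext; simp [h0]
      rw [this, zero_mul] at h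
      exact zero_ne_one h
    obtain ⟨p, hp, q, hq, hne, hup, huq⟩ := TwoUniqueProds.uniqueMul_of_one_lt_card
      (A := v.coeff.support) (B := u.coeff.support)
      (Nat.one_lt_mul_iff.2 ⟨hv0.card_pos, by lia, by lia⟩)
    rw [Finset.mem_product] at hp hq
    have key : ∀ x : G × G, x.1 ∈ v.coeff.support → x.2 ∈ u.coeff.support →
        UniqueMul v.coeff.support u.coeff.support x.1 x.2 → x.1 * x.2 = 1 := by
      intro x hx1 hx2 hx
      have h1 : (v * u).coeff (x.1 * x.2) = v.coeff x.1 * u.coeff x.2 :=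
        MonoidAlgebra.coeff_mul_mul_of_uniqueMul hx
      have h2 : (v * u).coeff (x.1 * x.2) ≠ 0 := by
        rw [h1]
        exact mul_ne_zero (Finsupp.mem_support_iff.1 hx1) (Finsupp.mem_support_iff.1 hx2)
      rw [h] at h2
      by_contra hne1
      exact h2 (by simp [MonoidAlgebra.one_def, Ne.symm hne1])
    have hpq := (key p hp.1 hp.2 hup).trans (key q hq.1 hq.2 huq).symm
    have := huq hp.1 hp.2 hpq
    exact hne (Prod.ext this.1 this.2)
  obtain ⟨g, r, hg⟩ := Finsupp.card_support_le_one'.1 hu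
  exact ⟨g, r, by ext; simp [hg]⟩

/-! ### Fox calculus -/

namespace FreeGroup

variable {α : Type*}

open Classical in
/-- The Fox derivative, with respect to the generator `e`, of a letter. -/
noncomputable def foxLetter (e : α) (d : α × Bool) : MonoidAlgebra ℤ (FreeGroup α) :=
  if d.1 = e then
    if d.2 then 1 else -MonoidAlgebra.single (FreeGroup.mk [d]) 1
  else 0

/-- The Fox derivative, with respect to the generator `e`, of a word. -/
noncomputable def foxWord (e : α) : List (α × Bool) → MonoidAlgebra ℤ (FreeGroup α)
  | [] => 0
  | d :: w => foxLetter e d + MonoidAlgebra.single (FreeGroup.mk [d]) 1 * foxWord e w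

theorem foxWord_append (e : α) (w w' : List (α × Bool)) :
    foxWord e (w ++ w') =
      foxWord e w + MonoidAlgebra.single (FreeGroup.mk w) 1 * foxWord e w' := by
  induction w with
  | nil => simp [foxWord, ← one_eq_mk, ← MonoidAlgebra.one_def]
  | cons d w ih =>
    have h : FreeGroup.mk (d :: w) = FreeGroup.mk [d] * FreeGroup.mk w := by simp
    rw [List.cons_append, foxWord, ih, foxWord, h, mul_add, ← mul_assoc,
      MonoidAlgebra.single_mul_single, mul_one, add_assoc]

theorem foxWord_cancel (e : α) (x : α) (b : Bool) : foxWord e [(x, b), (x, !b)] = 0 := by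
  have h : FreeGroup.mk [(x, b)] * FreeGroup.mk [(x, !b)] = 1 := by
    rw [mul_mk, one_eq_mk]
    exact Quot.sound (Red.Step.not (L₁ := []) (L₂ := []))
  by_cases hx : x = e
  · cases b
    · simp [foxWord, foxLetter, hx]
    · have h' := h
      simp only [Bool.not_true] at h'
      subst hx
      simp only [foxWord, foxLetter, if_true, Bool.not_true, mul_zero, add_zero]
      simp only [Bool.false_eq_true, if_false, mul_neg, MonoidAlgebra.single_mul_single]
      rw [h', mul_one, ← MonoidAlgebra.one_def, add_neg_cancel]
  · simp [foxWord, foxLetter, hx]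

theorem foxWord_step (e : α) {w w' : List (α × Bool)} (h : Red.Step w w') :
    foxWord e w = foxWord e w' := by
  induction h with
  | @not L₁ L₂ x b =>
    have h : L₁ ++ (x, b) :: (x, !b) :: L₂ = L₁ ++ ([(x, b), (x, !b)] ++ L₂) := rfl
    have h' : FreeGroup.mk [(x, b), (x, !b)] = 1 :=
      Quot.sound (Red.Step.not (L₁ := []) (L₂ := []))
    rw [h, foxWord_append, foxWord_append, foxWord_append, foxWord_cancel, h', zero_add,
      ← MonoidAlgebra.one_def, one_mul]

/-- The Fox derivative with respect to the generator `e`. -/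
noncomputable def fox (e : α) : FreeGroup α → MonoidAlgebra ℤ (FreeGroup α) :=
  Quot.lift (foxWord e) fun _ _ h => foxWord_step e h

theorem fox_mk (e : α) (w : List (α × Bool)) : fox e (FreeGroup.mk w) = foxWord e w := rfl

theorem fox_mul (e : α) (g h : FreeGroup α) :
    fox e (g * h) = fox e g + MonoidAlgebra.single g 1 * fox e h := by
  induction g using Quot.ind
  induction h using Quot.ind
  exact foxWord_append e _ _

@[simp]
theorem fox_one (e : α) : fox e 1 = 0 := rfl

theorem fox_inv (e : α) (g : FreeGroup α) :
    fox e g⁻¹ = -(MonoidAlgebra.single g⁻¹ 1 * fox e g) := by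
  have h := fox_mul e g⁻¹ g
  rw [inv_mul_cancel, fox_one] at h
  exact eq_neg_of_add_eq_zero_left h.symm

@[simp]
theorem fox_of_self (e : α) : fox e (of e) = 1 := by
  simp [of, fox_mk, foxWord, foxLetter]

theorem fox_of_ne {e x : α} (h : x ≠ e) : fox e (of x) = 0 := by
  simp [of, fox_mk, foxWord, foxLetter, h]

theorem foxWord_eq_zero {e : α} {w : List (α × Bool)} (h : ∀ d ∈ w, d.1 ≠ e) :
    foxWord e w = 0 := by
  induction w with
  | nil => rfl
  | cons d w ih =>
    rw [foxWord, ih fun d' hd' => h d' (List.mem_cons_of_mem _ hd'), foxLetter,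
      if_neg (h d List.mem_cons_self), mul_zero, add_zero]

/-- The chain rule of the Fox calculus. -/
theorem fox_map [Fintype α] {β : Type*} (e : β) (θ : FreeGroup α →* FreeGroup β)
    (g : FreeGroup α) :
    fox e (θ g) = ∑ b, MonoidAlgebra.mapDomainRingHom ℤ θ (fox b g) * fox e (θ (of b)) := by
  classical
  induction g using FreeGroup.induction_on with
  | C1 => simp
  | of x =>
    rw [Finset.sum_eq_single x]
    · simp
    · intro b _ hb
      rw [fox_of_ne hb.symm]; simp
    · simp
  | inv_of x hx =>
    rw [_root_.map_inv, fox_inv, hx, Finset.mul_sum, ← Finset.sum_neg_distrib]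
    refine Finset.sum_congr rfl fun b _ => ?_
    rw [fox_inv, map_neg, _root_.map_mul, neg_mul, mul_assoc]
    simp
  | mul x y hx hy =>
    rw [_root_.map_mul, fox_mul, hx, hy, Finset.mul_sum, ← Finset.sum_add_distrib]
    refine Finset.sum_congr rfl fun b _ => ?_
    rw [fox_mul, map_add, _root_.map_mul, add_mul, mul_assoc]
    simp

/-- An element in the support of the Fox derivative of a reduced word is a prefix of the word. -/
theorem prefix_of_mem_support_foxWord {e : α} {w : List (α × Bool)} (hw : IsReduced w)
    {h : FreeGroup α} (hh : h ∈ (foxWord e w).coeff.support) [DecidableEq α] :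
    h.toWord <+: w ∧ (h = 1 → w.head? = some (e, true)) := by
  induction w generalizing h with
  | nil => simp [foxWord] at hh
  | cons d w ih =>
    rw [foxWord, MonoidAlgebra.coeff_add] at hh
    rcases Finset.mem_union.1 (Finsupp.support_add hh) with h1 | h1
    · obtain ⟨x, b⟩ := d
      by_cases hx : x = e
      · subst hx
        cases b
        · simp [foxLetter, Finsupp.support_neg] at h1
          subst h1
          refine ⟨by simp [FreeGroup.toWord_mk], fun h => ?_⟩
          have := congrArg toWord h
          simp [toWord_mk] at this
        · simp [foxLetter] at h1
          subst h1
          simp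
      · simp [foxLetter, hx] at h1
    -- The terms coming from the tail are its prefixes multiplied by `d`. As the word is reduced,
    -- they are nonempty prefixes, so none of them is `1`.
    · obtain ⟨h', hh', rfl⟩ :=
        Finset.mem_image.1 (MonoidAlgebra.support_coeff_single_mul_subset _ _ _ h1)
      have hpre := (ih (List.IsChain.tail hw) hh').1
      have hred : IsReduced (d :: h'.toWord) :=
        List.IsChain.prefix hw (List.cons_prefix_cons.2 ⟨rfl, hpre⟩)
      have hword : (FreeGroup.mk [d] * h').toWord = d :: h'.toWord := by
        conv_lhs => rw [← mk_toWord (x := h'), mul_mk, toWord_mk]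
        exact hred.reduce_eq
      refine ⟨by rw [hword]; exact List.cons_prefix_cons.2 ⟨rfl, hpre⟩, fun h1 => ?_⟩
      rw [h1, toWord_one] at hword
      exact absurd hword (by simp)

/-- The number of terms of the Fox derivative of a reduced word is the number of occurrences of the
generator. -/
theorem card_support_foxWord [DecidableEq α] {e : α} {w : List (α × Bool)} (hw : IsReduced w) :
    (foxWord e w).coeff.support.card = (w.map Prod.fst).count e := by
  induction w with
  | nil => simp [foxWord]
  | cons d w ih =>
    have hcard :
        (MonoidAlgebra.single (FreeGroup.mk [d]) (1 : ℤ) * foxWord e w).coeff.support.card =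
          (w.map Prod.fst).count e := by
      rw [MonoidAlgebra.support_coeff_single_mul _ _ (by simp), Finset.card_map,
        ih (List.IsChain.tail hw)]
    by_cases hd : d.1 = e
    · obtain ⟨x, b⟩ := d
      obtain rfl : x = e := hd
      have hsupp : (foxLetter x (x, b)).coeff.support =
          {if b then 1 else FreeGroup.mk [(x, b)]} := by
        cases b
        · simp [foxLetter, Finsupp.support_neg, Finsupp.support_single]
        · simp [foxLetter]
          rfl
      -- If the term of the first letter met a shifted term of the tail, the tail would begin with
      -- the inverse letter. For an inverse letter this is what the clause on `h = 1` in the prefix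
      -- lemma provides.
      have hdisj : Disjoint (foxLetter x (x, b)).coeff.support
          (MonoidAlgebra.single (FreeGroup.mk [(x, b)]) (1 : ℤ) * foxWord x w).coeff.support := by
        rw [hsupp, Finset.disjoint_singleton_left]
        intro hmem
        obtain ⟨h', hh', heq⟩ :=
          Finset.mem_image.1 (MonoidAlgebra.support_coeff_single_mul_subset _ _ _ hmem)
        have hpre := prefix_of_mem_support_foxWord (List.IsChain.tail hw) hh'
        cases b
        · have h1 : h' = 1 := by simpa using heq
          obtain ⟨w', hw'⟩ := List.head?_eq_some_iff.1 (hpre.2 h1)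
          rw [List.tail_cons] at hw'
          rw [hw', isReduced_cons_cons] at hw
          exact absurd (hw.1 rfl) (by simp)
        · have h1 : h' = FreeGroup.mk [(x, false)] := by
            have : FreeGroup.mk [(x, true)] * h' = 1 := by simpa using heq
            rw [eq_inv_of_mul_eq_one_right this, inv_mk]
            rfl
          have h2 := hpre.1
          rw [h1, toWord_mk, reduce_singleton] at h2
          obtain ⟨w', hw'⟩ := h2
          rw [List.tail_cons] at hw'
          rw [← hw', List.singleton_append, isReduced_cons_cons] at hw
          exact absurd (hw.1 rfl) (by simp)
      rw [foxWord, MonoidAlgebra.coeff_add, Finsupp.support_add_eq hdisj,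
        Finset.card_union_of_disjoint hdisj, hcard, hsupp, Finset.card_singleton, List.map_cons,
        List.count_cons_self, add_comm]
    · rw [foxWord, foxLetter, if_neg hd, zero_add, hcard, List.map_cons, List.count_cons_of_ne]
      exact hd

theorem card_support_fox [DecidableEq α] (e : α) (g : FreeGroup α) :
    (fox e g).coeff.support.card = (g.toWord.map Prod.fst).count e := by
  rw [← card_support_foxWord isReduced_toWord, ← fox_mk, mk_toWord]

end FreeGroup

/-! ### Support sizes in monoid algebras. -/

theorem MonoidAlgebra.card_support_mul_le {R G : Type*} [Semiring R] [Mul G]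
    (x y : MonoidAlgebra R G) :
    (x * y).coeff.support.card ≤ x.coeff.support.card * y.coeff.support.card := by
  classical
  exact (Finset.card_le_card (MonoidAlgebra.support_coeff_mul_subset x y)).trans
    (Finset.card_mul_le)

theorem MonoidAlgebra.card_support_mapDomain_le {R G H : Type*} [Semiring R] (θ : G → H)
    (x : MonoidAlgebra R G) :
    (MonoidAlgebra.mapDomain θ x).coeff.support.card ≤ x.coeff.support.card := by
  classical
  rw [MonoidAlgebra.coeff_mapDomain]
  exact (Finset.card_le_card Finsupp.mapDomain_support).trans Finset.card_image_le

theorem MonoidAlgebra.card_support_single_le {R G : Type*} [Semiring R] (g : G) (r : R) :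
    (MonoidAlgebra.single g r).coeff.support.card ≤ 1 :=
  (Finset.card_le_card Finsupp.support_single_subset).trans (Finset.card_singleton g).le

/-! ### Edge paths and their homotopy classes -/

namespace CellGraph

theorem isReduced_invRev {E : Type*} {w : List (E × Bool)} (h : FreeGroup.IsReduced w) :
    FreeGroup.IsReduced (FreeGroup.invRev w) := by
  classical
  rw [FreeGroup.isReduced_iff_reduce_eq, FreeGroup.reduce_invRev, h.reduce_eq]

theorem flip_flip {E : Type*} (d : E × Bool) : flip (flip d) = d := by simp [flip]

section Paths

variable {V E : Type*} {Γ : CellGraph V E}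

@[simp]
theorem init_flip (d : E × Bool) : Γ.init (flip d) = Γ.term d := by
  obtain ⟨e, b⟩ := d
  cases b <;> rfl

@[simp]
theorem term_flip (d : E × Bool) : Γ.term (flip d) = Γ.init d := by
  obtain ⟨e, b⟩ := d
  cases b <;> rfl

theorem isPath_append {u v : V} {w w' : List (E × Bool)} :
    Γ.IsPath u v (w ++ w') ↔ ∃ x, Γ.IsPath u x w ∧ Γ.IsPath x v w' := by
  refine ⟨fun h => ?_, fun ⟨x, h, h'⟩ => h.append h'⟩
  induction w generalizing u with
  | nil => exact ⟨u, rfl, h⟩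
  | cons d w ih =>
    obtain ⟨x, hx, hx'⟩ := ih h.2
    exact ⟨x, ⟨h.1, hx⟩, hx'⟩

theorem IsPath.step {u v : V} {w w' : List (E × Bool)} (h : Γ.IsPath u v w)
    (hs : FreeGroup.Red.Step w w') : Γ.IsPath u v w' := by
  induction hs with
  | @not L₁ L₂ x b =>
    obtain ⟨y, h1, h2, h3, h4⟩ := isPath_append.1 h
    have h5 : Γ.term (x, !b) = y := by
      rw [← h2, ← term_flip]; rfl
    rw [h5] at h4
    exact h1.append h4

theorem IsPath.red {u v : V} {w w' : List (E × Bool)} (h : Γ.IsPath u v w)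
    (hr : FreeGroup.Red w w') : Γ.IsPath u v w' := by
  induction hr with
  | refl => exact h
  | tail _ hs ih => exact ih.step hs

open Classical in
/-- The element `g` of the free group on the edge set is the homotopy class of a path from `u` to
`v`. -/
def Joins (Γ : CellGraph V E) (u v : V) (g : FreeGroup E) : Prop := Γ.IsPath u v g.toWord

theorem IsPath.joins {u v : V} {w : List (E × Bool)} (h : Γ.IsPath u v w) :
    Γ.Joins u v (FreeGroup.mk w) := by
  classical
  rw [Joins, FreeGroup.toWord_mk]
  convert h.red FreeGroup.reduce.red

theorem Joins.exists_isPath {u v : V} {g : FreeGroup E} (h : Γ.Joins u v g) :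
    ∃ w, Γ.IsPath u v w ∧ FreeGroup.mk w = g := by
  classical
  exact ⟨_, h, FreeGroup.mk_toWord⟩

theorem Joins.refl (v : V) : Γ.Joins v v 1 := IsPath.joins (w := []) rfl

theorem Joins.mul {u v x : V} {g h : FreeGroup E} (hg : Γ.Joins u v g) (hh : Γ.Joins v x h) :
    Γ.Joins u x (g * h) := by
  obtain ⟨w, hw, rfl⟩ := hg.exists_isPath
  obtain ⟨w', hw', rfl⟩ := hh.exists_isPath
  rw [FreeGroup.mul_mk]
  exact (hw.append hw').joins

theorem Joins.inv {u v : V} {g : FreeGroup E} (hg : Γ.Joins u v g) : Γ.Joins v u g⁻¹ := by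
  obtain ⟨w, hw, rfl⟩ := hg.exists_isPath
  rw [FreeGroup.inv_mk]
  exact hw.invRev.joins

theorem Joins.pow {u : V} {g : FreeGroup E} (hg : Γ.Joins u u g) (n : ℕ) :
    Γ.Joins u u (g ^ n) := by
  induction n with
  | zero => exact pow_zero g ▸ Joins.refl u
  | succ n ih => exact pow_succ g n ▸ ih.mul hg

theorem joins_letter (d : E × Bool) : Γ.Joins (Γ.init d) (Γ.term d) (FreeGroup.mk [d]) :=
  IsPath.joins (w := [d]) ⟨rfl, rfl⟩

theorem joins_of (e : E) : Γ.Joins (Γ.src e) (Γ.tgt e) (FreeGroup.of e) :=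
  joins_letter (e, true)

theorem mem_fundamentalGroup {v : V} {g : FreeGroup E} :
    g ∈ Γ.fundamentalGroup v ↔ Γ.Joins v v g :=
  ⟨fun ⟨_, hw, h⟩ => h ▸ hw.joins, fun h => h.exists_isPath⟩

theorem Connected.exists_joins (h : Γ.Connected) (u v : V) : ∃ g, Γ.Joins u v g :=
  let ⟨_, hw⟩ := h u v
  ⟨_, hw.joins⟩

end Paths

/-! ### Words in a subgraph and counting of letters. -/

open Classical in
/-- The elements of the free group whose reduced word uses only generators in `S`. -/
def supportedIn {E : Type*} (S : Set E) : Subgroup (FreeGroup E) where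
  carrier := {g | ∀ d ∈ g.toWord, d.1 ∈ S}
  one_mem' := by simp
  mul_mem' := by
    intro g h hg hh d hd
    rcases List.mem_append.1 ((FreeGroup.toWord_mul_sublist g h).subset hd) with h1 | h1
    exacts [hg d h1, hh d h1]
  inv_mem' := by
    intro g hg d hd
    rw [FreeGroup.toWord_inv, FreeGroup.invRev, List.mem_reverse, List.mem_map] at hd
    obtain ⟨d', hd', rfl⟩ := hd
    exact hg d' hd'

theorem mem_supportedIn {E : Type*} [DecidableEq E] {S : Set E} {g : FreeGroup E} :
    g ∈ supportedIn S ↔ ∀ d ∈ g.toWord, d.1 ∈ S := by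
  change (∀ d ∈ _, _) ↔ _
  convert Iff.rfl

theorem mk_mem_supportedIn {E : Type*} {S : Set E} {w : List (E × Bool)}
    (h : ∀ d ∈ w, d.1 ∈ S) : FreeGroup.mk w ∈ supportedIn S := by
  classical
  rw [mem_supportedIn, FreeGroup.toWord_mk]
  exact fun d hd => h d (FreeGroup.reduce.red.sublist.subset hd)

theorem of_mem_supportedIn {E : Type*} {S : Set E} {e : E} (h : e ∈ S) :
    FreeGroup.of e ∈ supportedIn S :=
  mk_mem_supportedIn (by simpa using h)

theorem supportedIn_mono {E : Type*} {S T : Set E} (h : S ⊆ T) :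
    supportedIn S ≤ supportedIn T := by
  classical
  intro g hg
  rw [mem_supportedIn] at hg ⊢
  exact fun d hd => h (hg d hd)

theorem fox_eq_zero_of_mem_supportedIn {E : Type*} {S : Set E} {e : E} (he : e ∉ S)
    {g : FreeGroup E} (hg : g ∈ supportedIn S) : FreeGroup.fox e g = 0 := by
  classical
  rw [mem_supportedIn] at hg
  rw [← FreeGroup.mk_toWord (x := g), FreeGroup.fox_mk]
  exact FreeGroup.foxWord_eq_zero fun d hd h => he (h ▸ hg d hd)

/-- Two homomorphisms which agree on the generators in `S` agree on the elements supported in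
`S`. -/
theorem hom_eq_of_mem_supportedIn {E G : Type*} [Group G] {S : Set E} {θ θ' : FreeGroup E →* G}
    (h : ∀ e ∈ S, θ (FreeGroup.of e) = θ' (FreeGroup.of e)) {g : FreeGroup E}
    (hg : g ∈ supportedIn S) : θ g = θ' g := by
  classical
  rw [mem_supportedIn] at hg
  rw [← FreeGroup.mk_toWord (x := g)]
  generalize g.toWord = w at hg
  induction w with
  | nil => simp [← FreeGroup.one_eq_mk]
  | cons d w ih =>
    have h1 : FreeGroup.mk (d :: w) = FreeGroup.mk [d] * FreeGroup.mk w := by simp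
    have h2 : θ (FreeGroup.mk [d]) = θ' (FreeGroup.mk [d]) := by
      obtain ⟨e, b⟩ := d
      have he := h e (hg (e, b) List.mem_cons_self)
      cases b
      · have h3 : FreeGroup.mk [(e, false)] = (FreeGroup.of e)⁻¹ := rfl
        rw [h3, map_inv, map_inv, he]
      · exact he
    rw [h1, map_mul, map_mul, h2, ih fun d' hd' => hg d' (List.mem_cons_of_mem _ hd')]

open Classical in
/-- The number of letters of the reduced word of `g` whose underlying generator lies in `H`. -/
noncomputable def letterCount {E : Type*} (H : Set E) (g : FreeGroup E) : ℕ :=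
  (g.toWord.filter fun d => d.1 ∈ H).length

section letterCount

variable {E : Type*} (H : Set E)

open Classical in
theorem letterCount_mk_of_isReduced {w : List (E × Bool)} (hw : FreeGroup.IsReduced w) :
    letterCount H (FreeGroup.mk w) = (w.filter fun d => d.1 ∈ H).length := by
  rw [letterCount, FreeGroup.toWord_mk, hw.reduce_eq]

theorem letterCount_mul_le (g h : FreeGroup E) :
    letterCount H (g * h) ≤ letterCount H g + letterCount H h := by
  classical
  rw [letterCount, letterCount, letterCount, ← List.length_append, ← List.filter_append]
  exact ((FreeGroup.toWord_mul_sublist g h).filter _).length_le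

theorem letterCount_inv (g : FreeGroup E) : letterCount H g⁻¹ = letterCount H g := by
  classical
  rw [letterCount, letterCount, FreeGroup.toWord_inv, FreeGroup.invRev, List.filter_reverse,
    List.length_reverse, List.filter_map, List.length_map]
  rfl

/-- Serves to change base points: the loss depends on the conjugator alone, so it stays constant
when `g` runs through powers of a loop. -/
theorem letterCount_le_conj (h g : FreeGroup E) :
    letterCount H g ≤ letterCount H (h * g * h⁻¹) + 2 * letterCount H h := by
  have h1 := letterCount_mul_le H (h⁻¹ * (h * g * h⁻¹)) h
  have h2 := letterCount_mul_le H h⁻¹ (h * g * h⁻¹)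
  rw [letterCount_inv] at h2
  have h3 : h⁻¹ * (h * g * h⁻¹) * h = g := by group
  rw [h3] at h1
  lia

open Classical in
theorem letterCount_le_sum_fox [Fintype E] (g : FreeGroup E) :
    letterCount H g ≤ ∑ e with e ∈ H, (FreeGroup.fox e g).coeff.support.card := by
  simp_rw [FreeGroup.card_support_fox]
  rw [letterCount]
  induction g.toWord with
  | nil => simp
  | cons d w ih =>
    simp only [List.map_cons, List.count_cons, Finset.sum_add_distrib]
    by_cases hd : d.1 ∈ H
    · rw [List.filter_cons_of_pos (by simpa using hd), List.length_cons]
      refine add_le_add ih ?_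
      refine le_trans ?_ (Finset.single_le_sum (f := fun e => if (d.1 == e) = true then 1 else 0)
        (fun _ _ => Nat.zero_le _) (Finset.mem_filter.2 ⟨Finset.mem_univ d.1, hd⟩))
      simp
    · rw [List.filter_cons_of_neg (by simpa using hd)]
      exact ih.trans (Nat.le_add_right _ _)

end letterCount

namespace EdgePathMap

variable {V E : Type*} {Γ : CellGraph V E} (f : Γ.EdgePathMap)

theorem isPath_oriented (d : E × Bool) :
    Γ.IsPath (f.vert (Γ.init d)) (f.vert (Γ.term d)) (f.oriented d) := by
  obtain ⟨e, b⟩ := d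
  cases b
  · exact (f.isPath e).invRev
  · exact f.isPath e

theorem isReduced_oriented (d : E × Bool) : FreeGroup.IsReduced (f.oriented d) := by
  obtain ⟨e, b⟩ := d
  cases b
  · exact isReduced_invRev (f.reduced e)
  · exact f.reduced e

theorem oriented_flip (d : E × Bool) : f.oriented (flip d) = FreeGroup.invRev (f.oriented d) := by
  obtain ⟨e, b⟩ := d
  cases b
  · simp [oriented, flip, FreeGroup.invRev_invRev]
  · simp [oriented, flip]

theorem isPath_path {u v : V} {w : List (E × Bool)} (h : Γ.IsPath u v w) :
    Γ.IsPath (f.vert u) (f.vert v) (f.path w) := by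
  induction w generalizing u with
  | nil => exact congrArg f.vert h
  | cons d w ih =>
    obtain ⟨rfl, h2⟩ := h
    exact (f.isPath_oriented d).append (ih h2)

theorem mk_path (w : List (E × Bool)) :
    FreeGroup.mk (f.path w) = f.onFreeGroup (FreeGroup.mk w) := by
  induction w with
  | nil => exact (map_one _).symm
  | cons d w ih =>
    have h : FreeGroup.mk (d :: w) = FreeGroup.mk [d] * FreeGroup.mk w := by simp
    have h2 : FreeGroup.mk (f.oriented d) = f.onFreeGroup (FreeGroup.mk [d]) := by
      obtain ⟨e, b⟩ := d
      cases b
      · have h3 : FreeGroup.mk [(e, false)] = (FreeGroup.of e)⁻¹ := rfl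
        rw [h3, map_inv, onFreeGroup, FreeGroup.lift_apply_of, FreeGroup.inv_mk]
        rfl
      · exact (FreeGroup.lift_apply_of (f := fun e => FreeGroup.mk (f.edge e))).symm
    rw [h, map_mul, ← ih, ← h2, FreeGroup.mul_mk]
    rfl

theorem joins_onFreeGroup {u v : V} {g : FreeGroup E} (h : Γ.Joins u v g) :
    Γ.Joins (f.vert u) (f.vert v) (f.onFreeGroup g) := by
  obtain ⟨w, hw, rfl⟩ := h.exists_isPath
  rw [← mk_path]
  exact (f.isPath_path hw).joins

theorem mem_oriented_fst {S : Set E} (hS : ∀ e ∈ S, ∀ d ∈ f.edge e, d.1 ∈ S) {d : E × Bool}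
    (hd : d.1 ∈ S) : ∀ d' ∈ f.oriented d, d'.1 ∈ S := by
  obtain ⟨e, b⟩ := d
  cases b
  · intro d' hd'
    simp only [oriented, FreeGroup.invRev, Bool.false_eq_true, if_false, List.mem_reverse,
      List.mem_map] at hd'
    obtain ⟨d'', h, rfl⟩ := hd'
    exact hS e hd d'' h
  · exact hS e hd

theorem mem_path_fst {S : Set E} (hS : ∀ e ∈ S, ∀ d ∈ f.edge e, d.1 ∈ S) {w : List (E × Bool)}
    (hw : ∀ d ∈ w, d.1 ∈ S) : ∀ d' ∈ f.path w, d'.1 ∈ S := by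
  intro d' hd'
  obtain ⟨d, hd, h⟩ := List.mem_flatMap.1 hd'
  exact f.mem_oriented_fst hS (hw d hd) d' h

theorem onFreeGroup_mem_supportedIn {S : Set E} (hS : ∀ e ∈ S, ∀ d ∈ f.edge e, d.1 ∈ S)
    {g : FreeGroup E} (hg : g ∈ supportedIn S) : f.onFreeGroup g ∈ supportedIn S := by
  classical
  rw [← FreeGroup.mk_toWord (x := g), ← mk_path]
  exact mk_mem_supportedIn (f.mem_path_fst hS (mem_supportedIn.1 hg))

/-- The endomorphism of the free group on the edge set induced by the iterate `f ^ k`. -/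
def iter : ℕ → FreeGroup E →* FreeGroup E
  | 0 => MonoidHom.id _
  | k + 1 => f.onFreeGroup.comp (iter k)

theorem iter_zero (g : FreeGroup E) : f.iter 0 g = g := rfl

theorem iter_succ (k : ℕ) (g : FreeGroup E) : f.iter (k + 1) g = f.onFreeGroup (f.iter k g) := rfl

theorem iter_add (k l : ℕ) (g : FreeGroup E) : f.iter (k + l) g = f.iter k (f.iter l g) := by
  induction k with
  | zero => rw [Nat.zero_add, iter_zero]
  | succ k ih => rw [Nat.add_right_comm, iter_succ, ih, iter_succ]

theorem joins_iter {u v : V} {g : FreeGroup E} (h : Γ.Joins u v g) (k : ℕ) :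
    Γ.Joins (f.vert^[k] u) (f.vert^[k] v) (f.iter k g) := by
  induction k with
  | zero => exact h
  | succ k ih =>
    rw [Function.iterate_succ_apply', Function.iterate_succ_apply', iter_succ]
    exact f.joins_onFreeGroup ih

theorem iter_mem_supportedIn {S : Set E} (hS : ∀ e ∈ S, ∀ d ∈ f.edge e, d.1 ∈ S)
    {g : FreeGroup E} (hg : g ∈ supportedIn S) (k : ℕ) : f.iter k g ∈ supportedIn S := by
  induction k with
  | zero => exact hg
  | succ k ih => exact f.onFreeGroup_mem_supportedIn hS ih

/-! ### Bijectivity of `f` and its iterates on fundamental groups. -/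

variable {f} {n : ℕ} {τ : Γ.Marking n} {Φ : OuterAut (FreeGroup (Fin n))}

/-- Conjugating by a path to the marked base point turns `f` into the automorphism `φ`, up to the
change of base point along `η`; so injectivity holds at every vertex. -/
theorem Represents.eq_one_of_onFreeGroup (hf : f.Represents τ Φ) (hΓ : Γ.Connected) {u : V}
    {g : FreeGroup E} (hg : Γ.Joins u u g) (h : f.onFreeGroup g = 1) : g = 1 := by
  obtain ⟨φ, -, η, hη, hφ⟩ := hf
  obtain ⟨q, hq⟩ := hΓ.exists_joins τ.base u
  obtain ⟨x, hx⟩ := τ.iso.surjective ⟨_, mem_fundamentalGroup.2 ((hq.mul hg).mul hq.inv)⟩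
  have h1 := hφ x
  rw [hx] at h1
  simp only [map_mul, h, mul_one, map_inv, mul_inv_cancel] at h1
  have h2 : x = 1 := by
    rw [← EmbeddingLike.map_eq_one_iff (f := φ), ← EmbeddingLike.map_eq_one_iff (f := τ.iso)]
    exact Subtype.ext h1
  rw [h2, map_one] at hx
  have h3 : (1 : FreeGroup E) = q * g * q⁻¹ := congrArg Subtype.val hx
  exact conj_eq_one_iff.1 h3.symm

theorem Represents.exists_onFreeGroup_eq (hf : f.Represents τ Φ) (hΓ : Γ.Connected) {u : V}
    {h : FreeGroup E} (hh : Γ.Joins (f.vert u) (f.vert u) h) :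
    ∃ g, Γ.Joins u u g ∧ f.onFreeGroup g = h := by
  obtain ⟨φ, -, η, hη, hφ⟩ := hf
  obtain ⟨q, hq⟩ := hΓ.exists_joins τ.base u
  have hr := hη.joins.mul (f.joins_onFreeGroup hq)
  obtain ⟨y, hy⟩ := τ.iso.surjective ⟨_, mem_fundamentalGroup.2 ((hr.mul hh).mul hr.inv)⟩
  obtain ⟨x, rfl⟩ := φ.surjective y
  have h1 := hφ x
  rw [hy] at h1
  simp only at h1
  refine ⟨q⁻¹ * τ.iso x * q, (hq.inv.mul (mem_fundamentalGroup.1 (τ.iso x).2)).mul hq, ?_⟩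
  rw [map_mul, map_mul, map_inv]
  have h2 : f.onFreeGroup (τ.iso x : FreeGroup E) = (FreeGroup.mk η)⁻¹ *
      (FreeGroup.mk η * f.onFreeGroup q * h * (FreeGroup.mk η * f.onFreeGroup q)⁻¹) *
      FreeGroup.mk η := by
    rw [h1]; group
  rw [h2]
  group

theorem Represents.eq_one_of_iter (hf : f.Represents τ Φ) (hΓ : Γ.Connected) {u : V}
    {g : FreeGroup E} (hg : Γ.Joins u u g) {k : ℕ} (h : f.iter k g = 1) : g = 1 := by
  induction k with
  | zero => exact h
  | succ k ih => exact ih (hf.eq_one_of_onFreeGroup hΓ (f.joins_iter hg k) h)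

theorem Represents.exists_iter_eq (hf : f.Represents τ Φ) (hΓ : Γ.Connected) {u : V} {k : ℕ}
    {h : FreeGroup E} (hh : Γ.Joins (f.vert^[k] u) (f.vert^[k] u) h) :
    ∃ g, Γ.Joins u u g ∧ f.iter k g = h := by
  induction k generalizing h with
  | zero => exact ⟨h, hh, rfl⟩
  | succ k ih =>
    rw [Function.iterate_succ_apply'] at hh
    obtain ⟨g', hg', rfl⟩ := hf.exists_onFreeGroup_eq hΓ hh
    obtain ⟨g, hg, rfl⟩ := ih hg'
    exact ⟨g, hg, rfl⟩

end EdgePathMap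

end CellGraph

/-! ### Paths in an exponential stratum of a relative train track map -/

namespace CellGraph

open Classical in
/-- The subword of the letters whose underlying generator lies in `H`. -/
noncomputable def restrict {E : Type*} (H : Set E) (w : List (E × Bool)) : List (E × Bool) :=
  w.filter fun d => d.1 ∈ H

section restrict

variable {E : Type*} (H : Set E)

theorem restrict_append (w w' : List (E × Bool)) :
    restrict H (w ++ w') = restrict H w ++ restrict H w' := List.filter_append _ _

theorem restrict_nil : restrict H ([] : List (E × Bool)) = [] := rfl

variable {H}

theorem mem_restrict {w : List (E × Bool)} {d : E × Bool} :
    d ∈ restrict H w ↔ d ∈ w ∧ d.1 ∈ H := by simp [restrict]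

theorem restrict_eq_self {w : List (E × Bool)} (h : ∀ d ∈ w, d.1 ∈ H) : restrict H w = w := by
  simpa [restrict, List.filter_eq_self] using h

theorem restrict_eq_nil {w : List (E × Bool)} (h : ∀ d ∈ w, d.1 ∉ H) : restrict H w = [] := by
  simpa [restrict, List.filter_eq_nil_iff] using h

theorem restrict_invRev (w : List (E × Bool)) :
    restrict H (FreeGroup.invRev w) = FreeGroup.invRev (restrict H w) := by
  rw [restrict, restrict, FreeGroup.invRev, FreeGroup.invRev, List.filter_reverse,
    List.filter_map]
  rfl

theorem letterCount_mk {w : List (E × Bool)} (hw : FreeGroup.IsReduced w) :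
    letterCount H (FreeGroup.mk w) = (restrict H w).length :=
  letterCount_mk_of_isReduced H hw

end restrict

namespace EdgePathMap

variable {V E : Type*} {Γ : CellGraph V E} (f : Γ.EdgePathMap)

/-- The image of a word, restricted to the letters in `H`. -/
noncomputable def pathIn (H : Set E) (w : List (E × Bool)) : List (E × Bool) :=
  restrict H (f.path w)

variable {f} {H : Set E}

theorem path_append (w w' : List (E × Bool)) : f.path (w ++ w') = f.path w ++ f.path w' :=
  List.flatMap_append

theorem path_singleton (d : E × Bool) : f.path [d] = f.oriented d := by simp [path]

theorem path_cons (d : E × Bool) (w : List (E × Bool)) :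
    f.path (d :: w) = f.oriented d ++ f.path w := rfl

theorem path_invRev (w : List (E × Bool)) :
    f.path (FreeGroup.invRev w) = FreeGroup.invRev (f.path w) := by
  induction w with
  | nil => rfl
  | cons d w ih =>
    rw [FreeGroup.invRev_cons, path_append, ih, path_cons, FreeGroup.invRev_append,
      ← oriented_flip, ← path_singleton (f := f) (flip d)]
    rfl

theorem iterate_pathIn_append (k : ℕ) (w w' : List (E × Bool)) :
    (f.pathIn H)^[k] (w ++ w') = (f.pathIn H)^[k] w ++ (f.pathIn H)^[k] w' := by
  induction k generalizing w w' with
  | zero => rfl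
  | succ k ih =>
    simp only [Function.iterate_succ_apply]
    rw [← ih, pathIn, pathIn, pathIn, path_append, restrict_append]

theorem iterate_pathIn_invRev (k : ℕ) (w : List (E × Bool)) :
    (f.pathIn H)^[k] (FreeGroup.invRev w) = FreeGroup.invRev ((f.pathIn H)^[k] w) := by
  induction k generalizing w with
  | zero => rfl
  | succ k ih =>
    simp only [Function.iterate_succ_apply]
    rw [← ih, pathIn, pathIn, path_invRev, restrict_invRev]

variable (f H) in
/-- The number of edges in `H` of the `k`-th iterated image of an edge. -/
noncomputable def growth (k : ℕ) (e : E) : ℕ := ((f.pathIn H)^[k] [(e, true)]).length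

theorem length_iterate_pathIn (k : ℕ) (w : List (E × Bool)) :
    ((f.pathIn H)^[k] w).length = (w.map fun d => f.growth H k d.1).sum := by
  induction w with
  | nil =>
    have h : ∀ k, (f.pathIn H)^[k] [] = [] := by
      intro k
      induction k with
      | zero => rfl
      | succ k ih => rw [Function.iterate_succ_apply]; exact ih
    simp [h]
  | cons d w ih =>
    rw [← List.singleton_append, iterate_pathIn_append, List.length_append, ih, List.map_append,
      List.sum_append]
    congr 1
    obtain ⟨e, b⟩ := d
    cases b
    · have h : [(e, false)] = FreeGroup.invRev [(e, true)] := rfl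
      rw [h, iterate_pathIn_invRev, FreeGroup.invRev_length]
      simp [growth, FreeGroup.invRev]
    · simp [growth]

theorem growth_succ (k : ℕ) (e : E) :
    f.growth H (k + 1) e = ((restrict H (f.edge e)).map fun d => f.growth H k d.1).sum := by
  rw [growth, Function.iterate_succ_apply, length_iterate_pathIn, pathIn, path_singleton]
  rfl

namespace Filtration

variable (F : f.Filtration) (i : Fin F.len)

/-- A reduced path in `G_{i+1}` which begins and ends with edges of the stratum and which crosses
no illegal turn of the stratum. -/
structure IsStratumPath (u v : V) (σ : List (E × Bool)) : Prop where
  isPath : Γ.IsPath u v σ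
  reduced : FreeGroup.IsReduced σ
  legal : F.StratumLegal i σ
  head : ∀ d ∈ σ.head?, d.1 ∈ F.stratum i
  last : ∀ d ∈ σ.getLast?, d.1 ∈ F.stratum i

variable {F i}

theorem isVertexOf_init {d : E × Bool} (hd : d.1 ∈ F.stratum i) :
    F.IsVertexOf i (Γ.init d) := by
  refine ⟨d.1, hd, ?_⟩
  obtain ⟨e, b⟩ := d
  cases b
  · exact Or.inr rfl
  · exact Or.inl rfl

theorem isVertexOf_term {d : E × Bool} (hd : d.1 ∈ F.stratum i) :
    F.IsVertexOf i (Γ.term d) := by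
  rw [← init_flip]
  exact isVertexOf_init (d := flip d) hd

theorem oriented_head? (d : E × Bool) : (f.oriented d).head? = some (f.direction d) :=
  List.head?_eq_some_head _

theorem oriented_getLast? (d : E × Bool) :
    (f.oriented d).getLast? = some (flip (f.direction (flip d))) := by
  have h := oriented_head? (f := f) (flip d)
  rw [oriented_flip, FreeGroup.invRev, List.head?_reverse, List.getLast?_map] at h
  obtain ⟨x, hx, hx'⟩ := Option.map_eq_some_iff.1 h
  rw [hx, ← hx']
  exact congrArg some (flip_flip x).symm

theorem isStratumPath_oriented [Fintype E] (hF : F.IsRelativeTrainTrack) (hi : F.IsExponential i)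
    {d : E × Bool} (hd : d.1 ∈ F.stratum i) :
    F.IsStratumPath i (f.vert (Γ.init d)) (f.vert (Γ.term d)) (f.oriented d) where
  isPath := f.isPath_oriented d
  reduced := f.isReduced_oriented d
  legal := by
    rw [← path_singleton]
    exact hF.legal_path i hi (Γ.init d) (Γ.term d) [d] ⟨rfl, rfl⟩ (by simpa using hd)
      (List.isChain_singleton _)
  head := by
    rw [oriented_head?]
    simpa using hF.direction_mem i hi d hd
  last := by
    rw [oriented_getLast?]
    simpa [flip] using hF.direction_mem i hi (flip d) hd

theorem isStratumPath_singleton {d : E × Bool} (hd : d.1 ∈ F.stratum i) :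
    F.IsStratumPath i (Γ.init d) (Γ.term d) [d] where
  isPath := ⟨rfl, rfl⟩
  reduced := List.isChain_singleton _
  legal := ⟨by simpa using hd.1, List.isChain_singleton _⟩
  head := by simpa using hd
  last := by simpa using hd

theorem legalTurn_direction {d d' : E × Bool} (h : f.LegalTurn d d') :
    f.LegalTurn (f.direction d) (f.direction d') := by
  intro k
  rw [← Function.iterate_succ_apply, ← Function.iterate_succ_apply]
  exact h (k + 1)

/-- Edges below the stratum have images below the stratum, so they contribute no stratum letter. -/
theorem pathIn_restrict {σ : List (E × Bool)} (hσ : ∀ d ∈ σ, d.1 ∈ F.sub i.succ) :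
    f.pathIn (F.stratum i) (restrict (F.stratum i) σ) = f.pathIn (F.stratum i) σ := by
  induction σ with
  | nil => rfl
  | cons d σ ih =>
    have ih' := ih fun d' hd' => hσ d' (List.mem_cons_of_mem _ hd')
    rw [← List.singleton_append, restrict_append]
    rw [pathIn, pathIn] at ih' ⊢
    rw [path_append, path_append, restrict_append, restrict_append, ih']
    congr 1
    by_cases hd : d.1 ∈ F.stratum i
    · rw [restrict_eq_self (w := [d]) (by simpa using hd)]
    · rw [restrict_eq_nil (w := [d]) (by simpa using hd), path_singleton, eq_comm]
      refine restrict_eq_nil fun d' hd' h => h.2 ?_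
      refine f.mem_oriented_fst (F.invariant i.castSucc) ?_ d' hd'
      by_contra hcon
      exact hd ⟨hσ d List.mem_cons_self, hcon⟩

theorem isReduced_junction {d d' : E × Bool} (h : flip d ≠ d') : d.1 = d'.1 → d.2 = d'.2 := by
  intro h1
  by_contra h2
  exact h (Prod.ext h1 (by simp only [flip]; grind))

theorem IsStratumPath.append {u x v : V} {σ τ : List (E × Bool)} (hσ : F.IsStratumPath i u x σ)
    (hτ : F.IsStratumPath i x v τ)
    (h : ∀ d ∈ σ.getLast?, ∀ d' ∈ τ.head?, f.LegalTurn (flip d) d') :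
    F.IsStratumPath i u v (σ ++ τ) where
  isPath := hσ.isPath.append hτ.isPath
  reduced := List.isChain_append.2 ⟨hσ.reduced, hτ.reduced, fun d hd d' hd' =>
    isReduced_junction (h d hd d' hd' 0)⟩
  legal := ⟨fun d hd => (List.mem_append.1 hd).elim (hσ.legal.1 d) (hτ.legal.1 d),
    List.isChain_append.2 ⟨hσ.legal.2, hτ.legal.2, fun d hd d' hd' _ _ => h d hd d' hd'⟩⟩
  head := by
    intro d hd
    rw [List.head?_append, Option.mem_def, Option.or_eq_some_iff] at hd
    exact hd.elim (hσ.head d) fun h => hτ.head d h.2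
  last := by
    intro d hd
    rw [List.getLast?_append, Option.mem_def, Option.or_eq_some_iff] at hd
    exact hd.elim (hτ.last d) fun h => hσ.last d h.2

/-- No legality is needed at the two junctions: each of those turns has one direction below the
stratum, which also excludes backtracking. -/
theorem IsStratumPath.append_connecting {u x y v : V} {σ β τ : List (E × Bool)}
    (hσ : F.IsStratumPath i u x σ) (hβ : Γ.IsPath x y β) (hβr : FreeGroup.IsReduced β)
    (hβs : ∀ d ∈ β, d.1 ∈ F.sub i.castSucc) (hβn : β ≠ []) (hτ : F.IsStratumPath i y v τ)
    (hσn : σ ≠ []) (hτn : τ ≠ []) : F.IsStratumPath i u v (σ ++ (β ++ τ)) := by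
  have hnot : ∀ d ∈ β, d.1 ∉ F.stratum i := fun d hd h => h.2 (hβs d hd)
  have j1 : ∀ d ∈ β.getLast?, ∀ d' ∈ τ.head?, d.1 ∉ F.stratum i ∧ d.1 ≠ d'.1 := by
    intro d hd d' hd'
    have h1 := hnot d (List.mem_of_getLast? hd)
    exact ⟨h1, fun h => h1 (h ▸ hτ.head d' hd')⟩
  have j2 : ∀ d ∈ σ.getLast?, ∀ d' ∈ (β ++ τ).head?, d'.1 ∉ F.stratum i ∧ d.1 ≠ d'.1 := by
    intro d hd d' hd'
    rw [List.head?_append_of_ne_nil _ hβn] at hd'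
    have h1 := hnot d' (List.mem_of_head? hd')
    exact ⟨h1, fun h => h1 (h ▸ hσ.last d hd)⟩
  refine ⟨hσ.isPath.append (hβ.append hτ.isPath), ?_, ⟨?_, ?_⟩, ?_, ?_⟩
  · exact List.isChain_append.2 ⟨hσ.reduced, List.isChain_append.2 ⟨hβr, hτ.reduced,
      fun d hd d' hd' h => absurd h (j1 d hd d' hd').2⟩,
      fun d hd d' hd' h => absurd h (j2 d hd d' hd').2⟩
  · intro d hd
    rcases List.mem_append.1 hd with h | h
    · exact hσ.legal.1 d h
    · rcases List.mem_append.1 h with h | h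
      · exact F.strictMono.monotone (Fin.castSucc_le_succ i) (hβs d h)
      · exact hτ.legal.1 d h
  · refine List.isChain_append.2 ⟨hσ.legal.2, List.isChain_append.2 ⟨?_, hτ.legal.2,
      fun d hd d' hd' h => absurd h (j1 d hd d' hd').1⟩,
      fun d hd d' hd' _ h => absurd h (j2 d hd d' hd').1⟩
    exact List.IsChain.imp_of_mem_imp (fun d d' hd _ _ h => absurd h (hnot d hd)) hβr
  · rw [List.head?_append_of_ne_nil _ hσn]
    exact hσ.head
  · rw [List.getLast?_append_of_ne_nil _ (by simp [hτn]), List.getLast?_append_of_ne_nil _ hτn]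
    exact hτ.last

/-- A relative train track map preserves the legal paths of an exponential stratum, and no edge of
the stratum gets lost when the image is tightened. -/
theorem IsStratumPath.exists_image [Fintype E] (hF : F.IsRelativeTrainTrack)
    (hi : F.IsExponential i) {u v : V} {σ : List (E × Bool)} (h : F.IsStratumPath i u v σ) :
    ∃ σ', F.IsStratumPath i (f.vert u) (f.vert v) σ' ∧
      FreeGroup.mk σ' = f.onFreeGroup (FreeGroup.mk σ) ∧
      restrict (F.stratum i) σ' = f.pathIn (F.stratum i) σ ∧
      σ'.head? = σ.head?.map f.direction := by
  classical
  induction hn : σ.length using Nat.strong_induction_on generalizing u σ with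
  | _ n ih =>
  cases σ with
  | nil => exact ⟨[], ⟨congrArg f.vert h.isPath, List.isChain_nil, ⟨by simp, List.isChain_nil⟩,
      by simp, by simp⟩, (map_one f.onFreeGroup).symm, rfl, rfl⟩
  | cons d rest =>
  have hd : d.1 ∈ F.stratum i := h.head d rfl
  -- The path splits into its first edge `d`, the maximal block `b` of lower edges after it, and a
  -- shorter stratum path `σ₂`.
  set P : E × Bool → Bool := fun d => decide (d.1 ∉ F.stratum i) with hP
  obtain ⟨b, σ₂, hrest, hb, hhead⟩ : ∃ b σ₂, rest = b ++ σ₂ ∧ (∀ d ∈ b, d.1 ∉ F.stratum i) ∧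
      (∀ d ∈ σ₂.head?, d.1 ∈ F.stratum i) := by
    refine ⟨rest.takeWhile P, rest.dropWhile P, List.takeWhile_append_dropWhile.symm, ?_, ?_⟩
    · intro x hx
      simpa [hP] using List.mem_takeWhile_imp hx
    · intro x hx
      have := List.head?_dropWhile_not P rest
      rw [hx] at this
      simpa [hP] using this
  subst hrest
  obtain ⟨hinit, hpath⟩ := h.isPath
  subst hinit
  obtain ⟨x, hbpath, hσ₂path⟩ := isPath_append.1 hpath
  have hsuff : σ₂ <:+ d :: (b ++ σ₂) := ⟨d :: b, by simp⟩
  have hσ₂ : F.IsStratumPath i x v σ₂ := by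
    refine ⟨hσ₂path, List.IsChain.suffix h.reduced hsuff, ⟨fun d' hd' => h.legal.1 d'
      (hsuff.subset hd'), List.IsChain.suffix h.legal.2 hsuff⟩, hhead, fun d' hd' => h.last d' ?_⟩
    rw [← List.cons_append, List.getLast?_append, hd']
    rfl
  obtain ⟨σ₂', hσ₂', hmk, hres, hhd⟩ := ih σ₂.length (by simp at hn; lia) hσ₂ rfl
  have hfd := isStratumPath_oriented hF hi hd
  have hbsub : ∀ d ∈ b, d.1 ∈ F.sub i.castSucc := by
    intro d' hd'
    by_contra hcon
    exact hb d' hd' ⟨h.legal.1 d' (by simp [hd']), hcon⟩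
  have hmkcons : FreeGroup.mk (d :: (b ++ σ₂)) =
      FreeGroup.mk [d] * (FreeGroup.mk b * FreeGroup.mk σ₂) := by simp
  have hmkd : FreeGroup.mk (f.oriented d) = f.onFreeGroup (FreeGroup.mk [d]) := by
    rw [← mk_path, path_singleton]
  by_cases hbnil : b = []
  · subst hbnil
    obtain rfl : Γ.term d = x := hbpath
    refine ⟨f.oriented d ++ σ₂', hfd.append hσ₂' ?_, ?_, ?_, ?_⟩
    -- The new turn is the image under `Df` of the legal turn between `d` and the first edge of
    -- `σ₂`.
    · intro x hx y hy
      rw [oriented_getLast?] at hx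
      obtain rfl := Option.mem_some_iff.1 hx
      rw [hhd] at hy
      obtain ⟨y, hy', rfl⟩ := Option.map_eq_some_iff.1 hy
      obtain ⟨σ₃, rfl⟩ := List.head?_eq_some_iff.1 hy'
      rw [flip_flip]
      exact legalTurn_direction ((List.isChain_cons_cons.1 h.legal.2).1 hd (hhead y rfl))
    · rw [← FreeGroup.mul_mk, hmk, hmkd, hmkcons, ← FreeGroup.one_eq_mk, one_mul, map_mul]
    · rw [restrict_append, hres, pathIn, pathIn, List.nil_append, path_cons, restrict_append]
    · rw [List.head?_append_of_ne_nil _ (f.oriented_ne_nil d), oriented_head?]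
      rfl
  -- A stratum path ends in the stratum, so `b` is followed by a stratum edge. Both endpoints of `b`
  -- are then vertices of the stratum, and its tightened image is nontrivial; this keeps the stratum
  -- edges on its two sides apart.
  · have hσ₂n : σ₂ ≠ [] := by
      rintro rfl
      have h1 := h.last (b.getLast hbnil) (by
        rw [List.append_nil, List.getLast?_cons, List.getLast?_eq_some_getLast hbnil]; rfl)
      exact hb _ (List.getLast_mem hbnil) h1
    have hσ₂n' : σ₂' ≠ [] := by
      rintro rfl
      obtain ⟨y, σ₃, rfl⟩ := List.exists_cons_of_ne_nil hσ₂n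
      exact absurd hhd (by simp)
    have hxv : F.IsVertexOf i x := by
      obtain ⟨y, σ₃, rfl⟩ := List.exists_cons_of_ne_nil hσ₂n
      rw [← hσ₂path.1]
      exact isVertexOf_init (hhead y rfl)
    have hbred : FreeGroup.IsReduced b :=
      List.IsChain.infix h.reduced ⟨[d], σ₂, by simp⟩
    have hne : FreeGroup.mk (f.path b) ≠ 1 :=
      hF.connecting_path i hi _ _ b hbpath hbred hbnil hbsub (isVertexOf_term hd) hxv
    have hβ : ∀ d ∈ FreeGroup.reduce (f.path b), d.1 ∈ F.sub i.castSucc := fun d' hd' =>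
      f.mem_path_fst (F.invariant i.castSucc) hbsub d'
        (FreeGroup.reduce.red.sublist.subset hd')
    have hβ' : ∀ w : List (E × Bool), (∀ d ∈ w, d.1 ∈ F.sub i.castSucc) →
        restrict (F.stratum i) w = [] := fun w hw =>
      restrict_eq_nil fun d' hd' h' => h'.2 (hw d' hd')
    refine ⟨f.oriented d ++ (FreeGroup.reduce (f.path b) ++ σ₂'),
      hfd.append_connecting ((f.isPath_path hbpath).red FreeGroup.reduce.red) ?_ hβ ?_ hσ₂'
        (f.oriented_ne_nil d) hσ₂n', ?_, ?_, ?_⟩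
    · rw [← FreeGroup.toWord_mk]
      exact FreeGroup.isReduced_toWord
    · rw [← FreeGroup.toWord_mk]
      exact fun h' => hne (FreeGroup.toWord_eq_nil_iff.1 h')
    · rw [← FreeGroup.mul_mk, ← FreeGroup.mul_mk, hmk, hmkd, hmkcons, FreeGroup.reduce.self,
        mk_path, map_mul, map_mul]
    · rw [restrict_append, restrict_append, hres, hβ' _ hβ, pathIn, pathIn, path_cons,
        path_append, restrict_append, restrict_append,
        hβ' (f.path b) (f.mem_path_fst (F.invariant i.castSucc) hbsub)]
    · rw [List.head?_append_of_ne_nil _ (f.oriented_ne_nil d), oriented_head?]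
      rfl

theorem IsStratumPath.exists_iterate [Fintype E] (hF : F.IsRelativeTrainTrack)
    (hi : F.IsExponential i) {u v : V} {σ : List (E × Bool)} (h : F.IsStratumPath i u v σ)
    (k : ℕ) :
    ∃ σ', F.IsStratumPath i (f.vert^[k] u) (f.vert^[k] v) σ' ∧
      FreeGroup.mk σ' = f.iter k (FreeGroup.mk σ) ∧
      restrict (F.stratum i) σ' = (f.pathIn (F.stratum i))^[k] (restrict (F.stratum i) σ) := by
  induction k with
  | zero => exact ⟨σ, h, rfl, rfl⟩
  | succ k ih =>
    obtain ⟨σ₁, h1, hmk, hres⟩ := ih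
    obtain ⟨σ₂, h2, hmk2, hres2, -⟩ := h1.exists_image hF hi
    refine ⟨σ₂, ?_, ?_, ?_⟩
    · rw [Function.iterate_succ_apply', Function.iterate_succ_apply']
      exact h2
    · rw [hmk2, hmk, iter_succ]
    · rw [hres2, Function.iterate_succ_apply', ← hres, pathIn_restrict h1.legal.1]

theorem IsStratumPath.letterCount_iter [Fintype E] (hF : F.IsRelativeTrainTrack)
    (hi : F.IsExponential i) {u v : V} {σ : List (E × Bool)} (h : F.IsStratumPath i u v σ)
    (k : ℕ) :
    letterCount (F.stratum i) (f.iter k (FreeGroup.mk σ)) =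
      ((f.pathIn (F.stratum i))^[k] (restrict (F.stratum i) σ)).length := by
  obtain ⟨σ', h', hmk, hres⟩ := h.exists_iterate hF hi k
  rw [← hmk, letterCount_mk h'.reduced, hres]

end Filtration

end EdgePathMap

end CellGraph

/-! ### Exponential growth -/

namespace CellGraph

namespace EdgePathMap

variable {V E : Type*} {Γ : CellGraph V E} {f : Γ.EdgePathMap}

namespace Filtration

variable {F : f.Filtration} {i : Fin F.len}

open Classical in
theorem growth_succ_eq_sum [Fintype E] (k : ℕ) (b : F.stratum i) :
    (f.growth (F.stratum i) (k + 1) b : ℝ) =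
      ∑ a : F.stratum i, f.growth (F.stratum i) k a * F.transitionMatrix i a b := by
  rw [growth_succ, transitionMatrix]
  simp only [Matrix.of_apply]
  generalize f.edge b = w
  induction w with
  | nil => simp [restrict_nil]
  | cons d w ih =>
    rw [← List.singleton_append, restrict_append, List.map_append, List.sum_append, Nat.cast_add,
      ih]
    simp only [List.map_append, List.count_append, Nat.cast_add, mul_add, Finset.sum_add_distrib]
    congr 1
    by_cases hd : d.1 ∈ F.stratum i
    · rw [restrict_eq_self (w := [d]) (by simpa using hd), Finset.sum_eq_single ⟨d.1, hd⟩]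
      · simp
      · intro a _ ha
        have : d.1 ≠ a := fun h => ha (Subtype.ext h.symm)
        simp [this]
      · simp
    · rw [restrict_eq_nil (w := [d]) (by simpa using hd), List.map_nil, List.sum_nil, Nat.cast_zero,
        eq_comm]
      refine Finset.sum_eq_zero fun a _ => ?_
      have : d.1 ≠ a := fun h => hd (h ▸ a.2)
      simp [this]

/-- A bound for one edge spreads to the whole stratum by irreducibility, whereas the growth vector
paired with the Perron–Frobenius eigenvector is multiplied by `lam > 1` at each step. -/
theorem exists_lt_growth [Fintype E] (hi : F.IsExponential i) (e : F.stratum i) (B : ℕ) :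
    ∃ k, B < f.growth (F.stratum i) k e := by
  classical
  obtain ⟨hirr, lam, x, hlam, hx, hMx⟩ := hi
  set g := f.growth (F.stratum i) with hg
  set M := F.transitionMatrix i with hM
  by_contra hcon
  push Not at hcon
  -- If `f(b)` crosses `a`, then step `k + 1` from `b` contains step `k` from `a`. Entries are
  -- natural numbers, so positive ones are at least `1`.
  have hstep : ∀ a b : F.stratum i, 0 < M a b → ∀ B : ℕ, (∀ k, g k b ≤ B) → ∀ k, g k a ≤ B := by
    intro a b hab B hb k
    have hnat : (1 : ℝ) ≤ M a b := by
      simp only [hM, transitionMatrix, Matrix.of_apply] at hab ⊢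
      exact_mod_cast hab
    have h1 : (g k a : ℝ) ≤ g (k + 1) b := by
      rw [hg, growth_succ_eq_sum]
      calc (g k a : ℝ) ≤ g k a * M a b := le_mul_of_one_le_right (Nat.cast_nonneg _) hnat
        _ ≤ _ := Finset.single_le_sum (f := fun a : F.stratum i => (g k a : ℝ) * M a b)
          (fun c _ => mul_nonneg (Nat.cast_nonneg _) (hirr.nonneg c b)) (Finset.mem_univ a)
    exact (Nat.cast_le.1 h1).trans (hb (k + 1))
  have hall : ∀ a : F.stratum i, ∀ k, g k a ≤ B := by
    intro a
    let := M.toQuiver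
    obtain ⟨p, -⟩ := hirr.connected a e
    suffices h : ∀ (c : F.stratum i) (p : Quiver.Path a c), (∀ k, g k c ≤ B) → ∀ k, g k a ≤ B from
      h e p hcon
    intro c p
    induction p with
    | nil => exact id
    | @cons b c p hbc ih => exact fun h => ih (hstep b c hbc.down B h)
  have hsum : ∀ k, ∑ b : F.stratum i, (g k b : ℝ) * x b = lam ^ k * ∑ b, x b := by
    intro k
    induction k with
    | zero => simp [hg, growth]
    | succ k ih =>
      calc ∑ b : F.stratum i, (g (k + 1) b : ℝ) * x b
          = ∑ b : F.stratum i, ∑ a : F.stratum i, (g k a : ℝ) * (M a b * x b) := by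
            refine Finset.sum_congr rfl fun b _ => ?_
            rw [hg, growth_succ_eq_sum, Finset.sum_mul]
            exact Finset.sum_congr rfl fun a _ => mul_assoc _ _ _
        _ = ∑ a : F.stratum i, (g k a : ℝ) * (M.mulVec x a) := by
            rw [Finset.sum_comm]
            simp only [Matrix.mulVec, dotProduct, Finset.mul_sum]
        _ = lam ^ (k + 1) * ∑ b, x b := by
            rw [hMx, pow_succ', mul_assoc, ← ih, Finset.mul_sum]
            refine Finset.sum_congr rfl fun a _ => ?_
            simp only [Pi.smul_apply, smul_eq_mul]
            ring
  have hpos : 0 < ∑ b, x b := Finset.sum_pos (fun b _ => hx b) ⟨e, Finset.mem_univ e⟩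
  obtain ⟨k, hk⟩ := pow_unbounded_of_one_lt (B : ℝ) hlam
  have h1 : lam ^ k * ∑ b, x b ≤ B * ∑ b, x b := by
    rw [← hsum, Finset.mul_sum]
    exact Finset.sum_le_sum fun b _ =>
      mul_le_mul_of_nonneg_right (Nat.cast_le.2 (hall b k)) (hx b).le
  exact absurd h1 (not_le.2 (mul_lt_mul_of_pos_right hk hpos))

/-- The image of a stratum edge begins with a stratum edge, so every letter contributes at least
one. -/
theorem length_le_pathIn [Fintype E] (hF : F.IsRelativeTrainTrack) (hi : F.IsExponential i)
    {w : List (E × Bool)} (hw : ∀ d ∈ w, d.1 ∈ F.stratum i) :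
    w.length ≤ (f.pathIn (F.stratum i) w).length := by
  induction w with
  | nil => simp
  | cons d w ih =>
    have hd := hw d List.mem_cons_self
    have h1 : 1 ≤ (restrict (F.stratum i) (f.oriented d)).length :=
      List.length_pos_of_mem (mem_restrict.2
        ⟨List.mem_of_head? (oriented_head? d), hF.direction_mem i hi d hd⟩)
    rw [pathIn, path_cons, restrict_append, List.length_append, List.length_cons]
    have h2 := ih fun d' hd' => hw d' (List.mem_cons_of_mem _ hd')
    rw [pathIn] at h2
    lia

theorem monotone_length_iterate_pathIn [Fintype E] (hF : F.IsRelativeTrainTrack)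
    (hi : F.IsExponential i) {w : List (E × Bool)} (hw : ∀ d ∈ w, d.1 ∈ F.stratum i) :
    Monotone fun k => ((f.pathIn (F.stratum i))^[k] w).length := by
  refine monotone_nat_of_le_succ fun k => ?_
  have h : ∀ d ∈ (f.pathIn (F.stratum i))^[k] w, d.1 ∈ F.stratum i := by
    cases k with
    | zero => exact hw
    | succ k =>
      rw [Function.iterate_succ_apply']
      exact fun d hd => (mem_restrict.1 hd).2
  rw [Function.iterate_succ_apply']
  exact length_le_pathIn hF hi h

theorem stratum_nonempty (F : f.Filtration) (i : Fin F.len) : (F.stratum i).Nonempty :=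
  Set.nonempty_of_ssubset (F.strictMono Fin.castSucc_lt_succ)

/-- Powers of a loop at an edge of the stratum are stratum paths. -/
theorem isStratumPath_replicate {d : E × Bool} {w : List (E × Bool)} (hd : d.1 ∈ F.stratum i)
    (hp : Γ.IsPath (Γ.init d) (Γ.init d) (d :: w))
    (hr : FreeGroup.IsReduced ((d :: w) ++ [d])) (hl : F.StratumLegal i ((d :: w) ++ [d])) (n : ℕ) :
    F.IsStratumPath i (Γ.init d) (Γ.term d) ((List.replicate n (d :: w)).flatten ++ [d]) := by
  have hhead : ∀ n, ((List.replicate n (d :: w)).flatten ++ [d]).head? = some d := by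
    intro n
    cases n with
    | zero => rfl
    | succ n => rw [List.replicate_succ]; rfl
  -- The extra final `d` makes the closing turn of the loop one of the turns assumed good, so copies
  -- can be concatenated.
  have hchain : ∀ {R : E × Bool → E × Bool → Prop}, List.IsChain R ((d :: w) ++ [d]) →
      ∀ n, List.IsChain R ((List.replicate n (d :: w)).flatten ++ [d]) := by
    intro R hR n
    induction n with
    | zero => exact List.isChain_singleton _
    | succ n ih =>
      rw [List.replicate_succ, List.flatten_cons, List.append_assoc]
      obtain ⟨h1, -, h3⟩ := List.isChain_append.1 hR
      refine List.isChain_append.2 ⟨h1, ih, fun x hx y hy => ?_⟩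
      rw [hhead n] at hy
      exact h3 x hx y hy
  refine ⟨?_, hchain hr n, ⟨?_, hchain hl.2 n⟩, ?_, ?_⟩
  · induction n with
    | zero => exact ⟨rfl, rfl⟩
    | succ n ih =>
      rw [List.replicate_succ, List.flatten_cons, List.append_assoc]
      exact hp.append ih
  · intro x hx
    refine hl.1 x ?_
    rcases List.mem_append.1 hx with h | h
    · obtain ⟨l, hl', hx'⟩ := List.mem_flatten.1 h
      rw [List.eq_of_mem_replicate hl'] at hx'
      exact List.mem_append_left _ hx'
    · exact List.mem_append_right _ h
  · intro x hx
    rw [hhead n] at hx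
    obtain rfl := Option.mem_some_iff.1 hx
    exact hd
  · intro x hx
    rw [List.getLast?_append_of_ne_nil _ (by simp)] at hx
    obtain rfl : d = x := by simpa using hx
    exact hd

theorem mk_flatten_replicate {α : Type*} (w : List (α × Bool)) (n : ℕ) :
    FreeGroup.mk (List.replicate n w).flatten = FreeGroup.mk w ^ n := by
  induction n with
  | zero => rfl
  | succ n ih => rw [List.replicate_succ, List.flatten_cons, ← FreeGroup.mul_mk, ih, pow_succ']

/-- Every exponential stratum of a relative train track map carries a loop all of whose powers
grow under iteration without cancellation. -/
theorem exists_growing_loop [Fintype E] (hF : F.IsRelativeTrainTrack) (hi : F.IsExponential i) :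
    ∃ (u : V) (c : FreeGroup E) (L : ℕ → ℕ), Γ.Joins u u c ∧ c ∈ supportedIn (F.sub i.succ) ∧
      Monotone L ∧ (∀ B, ∃ k, B < L k) ∧
      ∀ k n, n * L k ≤ letterCount (F.stratum i) (f.iter k c ^ n) := by
  classical
  obtain ⟨e, he⟩ := stratum_nonempty F i
  obtain ⟨K, hK⟩ := exists_lt_growth hi ⟨e, he⟩ (Fintype.card (E × Bool))
  obtain ⟨σ, hσ, -, hres⟩ :=
    (isStratumPath_singleton (d := (e, true)) he).exists_iterate hF hi K
  rw [restrict_eq_self (w := [(e, true)]) (by simpa using he)] at hres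
  -- Pigeonhole: the iterated image has more stratum letters than there are oriented edges, so some
  -- oriented edge `d` recurs. The segment from one occurrence to the next chosen one is the loop.
  have hdup : ¬ (restrict (F.stratum i) σ).Nodup := by
    intro h
    have h1 := h.length_le_card
    rw [hres] at h1
    exact absurd hK (not_lt.2 h1)
  rw [List.nodup_iff_forall_not_duplicate] at hdup
  push Not at hdup
  obtain ⟨d, hdup⟩ := hdup
  have hd : d.1 ∈ F.stratum i := (mem_restrict.1 hdup.mem).2
  have hsub : List.Sublist [d, d] σ := (List.duplicate_iff_sublist.1 hdup).trans List.filter_sublist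
  obtain ⟨r₁, r₂, rfl, hd₁, hd₂⟩ := List.cons_sublist_iff.1 hsub
  obtain ⟨s, t, rfl⟩ := List.append_of_mem hd₁
  obtain ⟨s', t', rfl⟩ := List.append_of_mem (List.singleton_sublist.1 hd₂)
  have hinfix : (d :: (t ++ s')) ++ [d] <:+: (s ++ d :: t) ++ (s' ++ d :: t') :=
    ⟨s, t', by simp⟩
  have hpath : Γ.IsPath (Γ.init d) (Γ.init d) (d :: (t ++ s')) := by
    obtain ⟨x, h1, h2⟩ := isPath_append.1 hσ.isPath
    obtain ⟨y, -, h3⟩ := isPath_append.1 h1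
    obtain ⟨z, h4, h5⟩ := isPath_append.1 h2
    refine ⟨rfl, h3.2.append ?_⟩
    rw [h5.1]
    exact h4
  have hr : FreeGroup.IsReduced ((d :: (t ++ s')) ++ [d]) := List.IsChain.infix hσ.reduced hinfix
  have hl : F.StratumLegal i ((d :: (t ++ s')) ++ [d]) :=
    ⟨fun x hx => hσ.legal.1 x (hinfix.subset hx), List.IsChain.infix hσ.legal.2 hinfix⟩
  set c := d :: (t ++ s') with hc
  set T := f.pathIn (F.stratum i) with hT
  have hcH : ∀ x ∈ restrict (F.stratum i) c, x.1 ∈ F.stratum i := fun x hx => (mem_restrict.1 hx).2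
  refine ⟨Γ.init d, FreeGroup.mk c, fun k => (T^[k] (restrict (F.stratum i) c)).length,
    hpath.joins, mk_mem_supportedIn fun x hx => hl.1 x (List.mem_append_left _ hx),
    monotone_length_iterate_pathIn hF hi hcH, fun B => ?_, fun k n => ?_⟩
  · obtain ⟨k, hk⟩ := exists_lt_growth hi ⟨d.1, hd⟩ B
    refine ⟨k, hk.trans_le ?_⟩
    have h1 : restrict (F.stratum i) c = [d] ++ restrict (F.stratum i) (t ++ s') := by
      rw [hc, ← List.singleton_append, restrict_append, restrict_eq_self (w := [d])
        (by simpa using hd)]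
    simp only [h1, hT]
    rw [length_iterate_pathIn]
    simp
  -- The stratum path is the `n`-th power followed by `d`; the contribution of the final `d` is
  -- removed by subadditivity of the letter count.
  · have h1 := (isStratumPath_replicate hd hpath hr hl n).letterCount_iter hF hi k
    have h2 := (isStratumPath_singleton hd).letterCount_iter hF hi k
    rw [restrict_append, iterate_pathIn_append, List.length_append, ← h2, ← FreeGroup.mul_mk,
      mk_flatten_replicate, map_mul, map_pow] at h1
    have h3 : (T^[k] (restrict (F.stratum i) (List.replicate n c).flatten)).length =
        n * (T^[k] (restrict (F.stratum i) c)).length := by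
      clear h1
      induction n with
      | zero => simp [restrict_nil, hT, length_iterate_pathIn]
      | succ n ih =>
        rw [List.replicate_succ, List.flatten_cons, restrict_append, hT, iterate_pathIn_append,
          List.length_append, ← hT, ih]
        ring
    have h4 := letterCount_mul_le (F.stratum i) (f.iter k (FreeGroup.mk c) ^ n)
      (f.iter k (FreeGroup.mk [d]))
    rw [h1] at h4
    simp only
    rw [← h3]
    exact Nat.le_of_add_le_add_right h4

end Filtration

end EdgePathMap

end CellGraph

/-! ### Spanning trees -/

namespace CellGraph

theorem supportedIn_le {E : Type*} {S : Set E} {K : Subgroup (FreeGroup E)}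
    (h : ∀ e ∈ S, FreeGroup.of e ∈ K) : supportedIn S ≤ K := by
  classical
  intro g hg
  rw [mem_supportedIn] at hg
  rw [← FreeGroup.mk_toWord (x := g)]
  generalize g.toWord = w at hg
  induction w with
  | nil => exact K.one_mem
  | cons d w ih =>
    have h1 : FreeGroup.mk (d :: w) = FreeGroup.mk [d] * FreeGroup.mk w := by simp
    rw [h1]
    refine K.mul_mem ?_ (ih fun d' hd' => hg d' (List.mem_cons_of_mem _ hd'))
    obtain ⟨e, b⟩ := d
    have he := h e (hg (e, b) List.mem_cons_self)
    cases b
    · exact K.inv_mem he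
    · exact he

section Tree

variable {V E : Type*} (Γ : CellGraph V E)

/-- A tree with vertex set `U` and edge set `T` containing the vertex `v`, and for every vertex
`u` of the tree the class `p u` of a path in the tree from `v` to `u`. -/
structure IsTreeAt (v : V) (U : Set V) (T : Set E) (p : V → FreeGroup E) : Prop where
  base : p v = 1
  base_mem : v ∈ U
  joins : ∀ u ∈ U, Γ.Joins v u (p u)
  supp : ∀ u ∈ U, p u ∈ supportedIn T
  src_mem : ∀ e ∈ T, Γ.src e ∈ U
  tgt_mem : ∀ e ∈ T, Γ.tgt e ∈ U
  edge : ∀ e ∈ T, p (Γ.src e) * FreeGroup.of e = p (Γ.tgt e)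

variable {Γ} {v : V} {U : Set V} {T : Set E} {p : V → FreeGroup E}

theorem isTreeAt_singleton (v : V) : Γ.IsTreeAt v {v} ∅ fun _ => 1 where
  base := rfl
  base_mem := rfl
  joins := by rintro u rfl; exact Joins.refl _
  supp := fun _ _ => Subgroup.one_mem _
  src_mem := by simp
  tgt_mem := by simp
  edge := by simp

open Classical in
theorem IsTreeAt.insert (h : Γ.IsTreeAt v U T p) {d : E × Bool} (h1 : Γ.init d ∈ U)
    (h2 : Γ.term d ∉ U) :
    Γ.IsTreeAt v (insert (Γ.term d) U) (insert d.1 T)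
      (Function.update p (Γ.term d) (p (Γ.init d) * FreeGroup.mk [d])) := by
  have hU : ∀ u ∈ U, Function.update p (Γ.term d) (p (Γ.init d) * FreeGroup.mk [d]) u = p u :=
    fun u hu => Function.update_of_ne (ne_of_mem_of_not_mem hu h2) _ _
  have hst : (Γ.src d.1 = Γ.init d ∧ Γ.tgt d.1 = Γ.term d) ∨
      (Γ.src d.1 = Γ.term d ∧ Γ.tgt d.1 = Γ.init d) := by
    obtain ⟨e, b⟩ := d
    cases b
    · exact Or.inr ⟨rfl, rfl⟩
    · exact Or.inl ⟨rfl, rfl⟩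
  refine ⟨?_, Set.mem_insert_of_mem _ h.base_mem, ?_, ?_, ?_, ?_, ?_⟩
  · rw [hU v h.base_mem, h.base]
  · rintro u (rfl | hu)
    · rw [Function.update_self]
      exact (h.joins _ h1).mul (joins_letter d)
    · rw [hU u hu]
      exact h.joins u hu
  · rintro u (rfl | hu)
    · rw [Function.update_self]
      exact Subgroup.mul_mem _ (supportedIn_mono (Set.subset_insert _ _) (h.supp _ h1))
        (mk_mem_supportedIn (by simp))
    · rw [hU u hu]
      exact supportedIn_mono (Set.subset_insert _ _) (h.supp u hu)
  · rintro e (rfl | he)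
    · rcases hst with h3 | h3 <;> rw [h3.1] <;> simp [h1]
    · exact Set.mem_insert_of_mem _ (h.src_mem e he)
  · rintro e (rfl | he)
    · rcases hst with h3 | h3 <;> rw [h3.2] <;> simp [h1]
    · exact Set.mem_insert_of_mem _ (h.tgt_mem e he)
  · rintro e (rfl | he)
    · obtain ⟨e, b⟩ := d
      cases b
      · change Function.update p (Γ.src e) _ (Γ.src e) * _ = Function.update p (Γ.src e) _ (Γ.tgt e)
        rw [Function.update_self]
        have := hU (Γ.tgt e) h1
        rw [show Γ.term (e, false) = Γ.src e from rfl] at this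
        rw [this, mul_assoc]
        have h4 : FreeGroup.mk [(e, false)] = (FreeGroup.of e)⁻¹ := rfl
        rw [h4, inv_mul_cancel, mul_one]
        rfl
      · change Function.update p (Γ.tgt e) _ (Γ.src e) * _ = Function.update p (Γ.tgt e) _ (Γ.tgt e)
        rw [Function.update_self]
        have := hU (Γ.src e) h1
        rw [show Γ.term (e, true) = Γ.tgt e from rfl] at this
        rw [this]
        rfl
    · rw [hU _ (h.src_mem e he), hU _ (h.tgt_mem e he), h.edge e he]

/-- Edges of `S` leaving the tree are added until none is left. Old tree paths are kept, so that
extensions can be nested. -/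
theorem IsTreeAt.exists_extension [Finite V] (h : Γ.IsTreeAt v U T p) (S : Set E) :
    ∃ U' T' p', Γ.IsTreeAt v U' T' p' ∧ U ⊆ U' ∧ T' ⊆ T ∪ S ∧ Set.EqOn p' p U ∧
      ∀ d : E × Bool, d.1 ∈ S → Γ.init d ∈ U' → Γ.term d ∈ U' := by
  classical
  induction hn : Uᶜ.ncard using Nat.strong_induction_on generalizing U T p with
  | _ n ih =>
  by_cases hcl : ∀ d : E × Bool, d.1 ∈ S → Γ.init d ∈ U → Γ.term d ∈ U
  · exact ⟨U, T, p, h, subset_rfl, Set.subset_union_left, fun _ _ => rfl, hcl⟩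
  push Not at hcl
  obtain ⟨d, hd, h1, h2⟩ := hcl
  have hlt : (Insert.insert (Γ.term d) U)ᶜ.ncard < n := by
    rw [← hn]
    refine Set.ncard_lt_ncard ?_ (Set.toFinite _)
    exact compl_lt_compl_iff_lt.2 (Set.ssubset_insert h2)
  obtain ⟨U', T', p', h', hU, hT, hp, hcl'⟩ := ih _ hlt (h.insert h1 h2) rfl
  refine ⟨U', T', p', h', (Set.subset_insert _ _).trans hU, ?_, fun u hu => ?_, hcl'⟩
  · intro e he
    rcases hT he with (rfl | h3) | h3
    exacts [Or.inr hd, Or.inl h3, Or.inr h3]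
  · rw [hp (Set.mem_insert_of_mem _ hu), Function.update_of_ne (ne_of_mem_of_not_mem hu h2)]

theorem IsPath.mem_of_closed {S : Set E}
    (hcl : ∀ d : E × Bool, d.1 ∈ S → Γ.init d ∈ U → Γ.term d ∈ U) {u x : V}
    {w : List (E × Bool)} (hw : Γ.IsPath u x w) (hS : ∀ d ∈ w, d.1 ∈ S) (hu : u ∈ U) : x ∈ U := by
  induction w generalizing u with
  | nil => exact (show u = x from hw) ▸ hu
  | cons d w ih =>
    obtain ⟨rfl, h2⟩ := hw
    exact ih h2 (fun d' hd' => hS d' (List.mem_cons_of_mem _ hd'))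
      (hcl d (hS d List.mem_cons_self) hu)

variable (Γ) in
/-- The vertex `u` is joined to `v` by a path in the subgraph `S`. -/
def Reachable (S : Set E) (v u : V) : Prop := ∃ g ∈ supportedIn S, Γ.Joins v u g

variable (Γ) in
/-- The edges of the component of `v` of the subgraph `S`. -/
def component (S : Set E) (v : V) : Set E := {e | e ∈ S ∧ Γ.Reachable S v (Γ.src e)}

/-- The tree is grown within `S` first and by arbitrary edges afterwards; thus tree paths to
vertices of the component of `v` stay in `S`. -/
theorem exists_spanningTree [Finite V] (hΓ : Γ.Connected) (v : V) (S : Set E) :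
    ∃ T p, Γ.IsTreeAt v Set.univ T p ∧ ∀ u, Γ.Reachable S v u → p u ∈ supportedIn S := by
  classical
  obtain ⟨U₁, T₁, p₁, h₁, -, hT₁, -, hcl₁⟩ := (isTreeAt_singleton (Γ := Γ) v).exists_extension S
  obtain ⟨U₂, T₂, p₂, h₂, -, -, hp₂, hcl₂⟩ := h₁.exists_extension Set.univ
  have hU₂ : U₂ = Set.univ := by
    refine Set.eq_univ_of_forall fun u => ?_
    obtain ⟨w, hw⟩ := hΓ v u
    exact hw.mem_of_closed hcl₂ (fun _ _ => Set.mem_univ _) h₂.base_mem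
  subst hU₂
  refine ⟨T₂, p₂, h₂, fun u ⟨g, hg, hj⟩ => ?_⟩
  have hu : u ∈ U₁ := IsPath.mem_of_closed hcl₁ hj
    (mem_supportedIn.1 hg) h₁.base_mem
  rw [hp₂ hu]
  exact supportedIn_mono (by simpa using hT₁) (h₁.supp u hu)

theorem mem_supportedIn_component {S : Set E} {u : V} {g : FreeGroup E} (hg : Γ.Joins v u g)
    (hS : g ∈ supportedIn S) : g ∈ supportedIn (Γ.component S v) := by
  classical
  rw [mem_supportedIn] at hS ⊢
  have key : ∀ (w : List (E × Bool)) (x : V), Γ.IsPath x u w → (∀ d ∈ w, d.1 ∈ S) →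
      Γ.Reachable S v x → ∀ d ∈ w, d.1 ∈ Γ.component S v := by
    intro w
    induction w with
    | nil => simp
    | cons d w ih =>
      rintro x ⟨rfl, hw⟩ hwS ⟨h, hh, hj⟩
      have hd := hwS d List.mem_cons_self
      have hterm : Γ.Reachable S v (Γ.term d) :=
        ⟨_, Subgroup.mul_mem _ hh (mk_mem_supportedIn (w := [d]) (by simpa using hd)),
          hj.mul (joins_letter d)⟩
      intro d' hd'
      rcases List.mem_cons.1 hd' with rfl | h'
      · refine ⟨hd, ?_⟩
        obtain ⟨e, b⟩ := d'
        cases b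
        · exact hterm
        · exact ⟨h, hh, hj⟩
      · exact ih _ hw (fun d hd => hwS d (List.mem_cons_of_mem _ hd)) hterm d' h'
  exact key _ v hg hS ⟨1, Subgroup.one_mem _, Joins.refl v⟩

/-! ### The retraction given by a spanning tree. -/

variable (Γ) in
/-- The retraction onto the fundamental group which is given by a spanning tree. -/
def retraction (p : V → FreeGroup E) : FreeGroup E →* FreeGroup E :=
  FreeGroup.lift fun e => p (Γ.src e) * FreeGroup.of e * (p (Γ.tgt e))⁻¹

theorem retraction_of (e : E) :
    Γ.retraction p (FreeGroup.of e) = p (Γ.src e) * FreeGroup.of e * (p (Γ.tgt e))⁻¹ :=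
  FreeGroup.lift_apply_of

/-- The tree paths at consecutive vertices telescope. -/
theorem retraction_of_joins {x y : V} {g : FreeGroup E} (h : Γ.Joins x y g) :
    Γ.retraction p g = p x * g * (p y)⁻¹ := by
  obtain ⟨w, hw, rfl⟩ := h.exists_isPath
  clear h
  induction w generalizing x with
  | nil =>
    obtain rfl : x = y := hw
    rw [← FreeGroup.one_eq_mk, map_one, mul_one, mul_inv_cancel]
  | cons d w ih =>
    obtain ⟨rfl, h2⟩ := hw
    have h1 : FreeGroup.mk (d :: w) = FreeGroup.mk [d] * FreeGroup.mk w := by simp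
    have h3 : Γ.retraction p (FreeGroup.mk [d]) =
        p (Γ.init d) * FreeGroup.mk [d] * (p (Γ.term d))⁻¹ := by
      obtain ⟨e, b⟩ := d
      cases b
      · have h4 : FreeGroup.mk [(e, false)] = (FreeGroup.of e)⁻¹ := rfl
        rw [h4, map_inv, retraction_of, show Γ.init (e, false) = Γ.tgt e from rfl,
          show Γ.term (e, false) = Γ.src e from rfl]
        group
      · exact retraction_of e
    rw [h1, map_mul, ih h2, h3]
    group

namespace IsTreeAt

variable (h : Γ.IsTreeAt v Set.univ T p)

include h

theorem retraction_eq_self {g : FreeGroup E} (hg : Γ.Joins v v g) : Γ.retraction p g = g := by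
  rw [retraction_of_joins hg, h.base, one_mul, inv_one, mul_one]

theorem retraction_of_mem {e : E} (he : e ∈ T) : Γ.retraction p (FreeGroup.of e) = 1 := by
  rw [retraction_of, h.edge e he, mul_inv_cancel]

theorem retraction_eq_one {g : FreeGroup E} (hg : g ∈ supportedIn T) : Γ.retraction p g = 1 :=
  hom_eq_of_mem_supportedIn (θ' := 1) (fun _ he => h.retraction_of_mem he) hg

theorem joins_retraction_of (e : E) : Γ.Joins v v (Γ.retraction p (FreeGroup.of e)) := by
  rw [retraction_of]
  exact ((h.joins _ trivial).mul (joins_of e)).mul (h.joins _ trivial).inv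

theorem hom_retraction_of {A : Type*} [CommGroup A] {χ : FreeGroup E →* A}
    (hχ : ∀ e ∈ T, χ (FreeGroup.of e) = 1) (e : E) :
    χ (Γ.retraction p (FreeGroup.of e)) = χ (FreeGroup.of e) := by
  have h1 : ∀ u, χ (p u) = 1 := fun u =>
    hom_eq_of_mem_supportedIn (θ' := 1) hχ (h.supp u trivial)
  rw [retraction_of, map_mul, map_mul, map_inv, h1, h1, inv_one, one_mul, mul_one]

theorem fox_retraction_of {t : E} (ht : t ∉ T) :
    FreeGroup.fox t (Γ.retraction p (FreeGroup.of t)) = MonoidAlgebra.single (p (Γ.src t)) 1 := by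
  have h1 : ∀ u, FreeGroup.fox t (p u) = 0 := fun u =>
    fox_eq_zero_of_mem_supportedIn ht (h.supp u trivial)
  rw [retraction_of, FreeGroup.fox_mul, FreeGroup.fox_mul, FreeGroup.fox_inv, h1, h1]
  simp

/-- The number of edges outside a spanning tree is at most the rank of the fundamental group. -/
theorem ncard_compl_le [Finite E] (hΓ : Γ.Connected) {n : ℕ} (τ : Γ.Marking n) :
    Tᶜ.ncard ≤ n := by
  classical
  -- Counting of mod `2` characters: labels on the edges outside `T` extend by the trivial value on
  -- `T` and are recovered from the loops they determine, so there are at most as many labellings as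
  -- characters of the free group of rank `n`.
  let χ : ((Tᶜ : Set E) → Multiplicative (ZMod 2)) → FreeGroup E →* Multiplicative (ZMod 2) :=
    fun a => FreeGroup.lift fun e => if h : e ∈ Tᶜ then a ⟨e, h⟩ else 1
  have hχT : ∀ a, ∀ e ∈ T, χ a (FreeGroup.of e) = 1 := by
    intro a e he
    rw [FreeGroup.lift_apply_of, dif_neg (by simpa using he)]
  have hχ : ∀ a (b : (Tᶜ : Set E)), χ a (FreeGroup.of b) = a b := by
    intro a b
    rw [FreeGroup.lift_apply_of, dif_pos b.2]
  let Ξ : ((Tᶜ : Set E) → Multiplicative (ZMod 2)) → Fin n → Multiplicative (ZMod 2) :=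
    fun a j => χ a (τ.iso (FreeGroup.of j))
  have hΞ : Function.Injective Ξ := by
    intro a a' haa'
    have h1 : (χ a).comp ((Γ.fundamentalGroup τ.base).subtype.comp τ.iso.toMonoidHom) =
        (χ a').comp ((Γ.fundamentalGroup τ.base).subtype.comp τ.iso.toMonoidHom) :=
      FreeGroup.ext_hom _ _ fun j => congrFun haa' j
    have h2 : ∀ g, Γ.Joins τ.base τ.base g → χ a g = χ a' g := by
      intro g hg
      obtain ⟨x, hx⟩ := τ.iso.surjective ⟨g, mem_fundamentalGroup.2 hg⟩
      have h3 := DFunLike.congr_fun h1 x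
      simpa [hx] using h3
    obtain ⟨q, hq⟩ := hΓ.exists_joins τ.base v
    funext b
    have h3 := h2 _ ((hq.mul (h.joins_retraction_of b)).mul hq.inv)
    simp only [map_mul, map_inv, mul_inv_cancel_comm] at h3
    rwa [h.hom_retraction_of (hχT a), h.hom_retraction_of (hχT a'), hχ, hχ] at h3
  have hcard := Nat.card_le_card_of_injective Ξ hΞ
  have h2 : Nat.card (Multiplicative (ZMod 2)) = 2 := by
    simp
  rw [Nat.card_fun, Nat.card_fun, h2, Nat.card_fin] at hcard
  exact (Nat.pow_le_pow_iff_right (by norm_num)).1 hcard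

end IsTreeAt

end Tree

end CellGraph

/-! ### Growth of loops and the rank of the fundamental group -/

namespace CellGraph

theorem card_support_fox_pow_le {E : Type*} (e : E) (g : FreeGroup E) (n : ℕ) :
    (FreeGroup.fox e (g ^ n)).coeff.support.card ≤
      n * (FreeGroup.fox e g).coeff.support.card := by
  classical
  induction n with
  | zero => simp
  | succ n ih =>
    rw [pow_succ, FreeGroup.fox_mul, MonoidAlgebra.coeff_add, add_mul, one_mul]
    refine (Finset.card_le_card Finsupp.support_add).trans ((Finset.card_union_le _ _).trans
      (add_le_add ih ?_))
    refine (MonoidAlgebra.card_support_mul_le _ _).trans ?_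
    exact (Nat.mul_le_mul_right _ (MonoidAlgebra.card_support_single_le _ _)).trans (one_mul _).le

section

variable {V E : Type*} {Γ : CellGraph V E} {v : V} {T S : Set E} {p : V → FreeGroup E}

theorem retraction_mem_supportedIn (hp : ∀ u, Γ.Reachable S v u → p u ∈ supportedIn S) {e : E}
    (he : e ∈ Γ.component S v) : Γ.retraction p (FreeGroup.of e) ∈ supportedIn S := by
  obtain ⟨heS, g, hg, hj⟩ := he
  have heS' := of_mem_supportedIn heS
  rw [retraction_of]
  exact Subgroup.mul_mem _ (Subgroup.mul_mem _ (hp _ ⟨g, hg, hj⟩) heS')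
    (Subgroup.inv_mem _ (hp _ ⟨_, Subgroup.mul_mem _ hg heS', hj.mul (joins_of e)⟩))

end

namespace EdgePathMap

variable {V E : Type*} {Γ : CellGraph V E} {f : Γ.EdgePathMap} {v : V} {T S : Set E}
  {p : V → FreeGroup E} {m n : ℕ} {τ : Γ.Marking n} {Φ : OuterAut (FreeGroup (Fin n))}

theorem joins_iter_of_periodic (hm : f.vert^[m] v = v) {g : FreeGroup E} (hg : Γ.Joins v v g)
    (k : ℕ) : Γ.Joins v v (f.iter (m * k) g) := by
  have h := f.joins_iter hg (m * k)
  rwa [Function.iterate_mul, Function.iterate_fixed hm] at h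

/-- If the component of the fixed vertex `v` of the subgraph `S` has rank at most one, then the loops
at `v` in `S` do not grow. -/
theorem letterCount_iter_eq_of_cyclic [Finite E] (hf : f.Represents τ Φ) (hΓ : Γ.Connected)
    (hm : f.vert^[m] v = v) (hS : ∀ e ∈ S, ∀ d ∈ f.edge e, d.1 ∈ S)
    (hT : Γ.IsTreeAt v Set.univ T p) (hp : ∀ u, Γ.Reachable S v u → p u ∈ supportedIn S)
    (hrank : (Γ.component S v \ T).ncard ≤ 1) {c : FreeGroup E} (hc : Γ.Joins v v c)
    (hcS : c ∈ supportedIn S) (H : Set E) (k : ℕ) :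
    letterCount H (f.iter (m * k) c) = letterCount H c := by
  classical
  -- The retractions of the edges of the component outside `T` generate the group of loops at `v` in
  -- `S`.
  have hmem : ∀ a, (∀ b ∈ Γ.component S v \ T, Γ.retraction p (FreeGroup.of b) ∈
      Subgroup.zpowers a) → ∀ g, Γ.Joins v v g → g ∈ supportedIn S → g ∈ Subgroup.zpowers a := by
    intro a ha g hg hgS
    rw [← hT.retraction_eq_self hg]
    have h1 : supportedIn (Γ.component S v) ≤ (Subgroup.zpowers a).comap (Γ.retraction p) := by
      refine supportedIn_le fun e he => ?_
      rw [Subgroup.mem_comap]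
      by_cases heT : e ∈ T
      · rw [hT.retraction_of_mem heT]
        exact Subgroup.one_mem _
      · exact ha e ⟨he, heT⟩
    exact h1 (mem_supportedIn_component hg hgS)
  rcases (Set.ncard_le_one_iff_eq (Set.toFinite _)).1 hrank with h0 | ⟨b, hb⟩
  · have h1 := hmem 1 (by simp [h0]) c hc hcS
    rw [Subgroup.zpowers_one_eq_bot, Subgroup.mem_bot] at h1
    rw [h1, map_one]
  · set a := Γ.retraction p (FreeGroup.of b) with ha
    have hbmem : b ∈ Γ.component S v \ T := by rw [hb]; rfl
    have haj : Γ.Joins v v a := hT.joins_retraction_of b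
    have haS : a ∈ supportedIn S := retraction_mem_supportedIn hp hbmem.1
    have hmem' := hmem a (by
      rw [hb]; rintro _ rfl; exact Subgroup.mem_zpowers a)
    -- The image of `a` is `a ^ d`. A preimage `y` of `a` satisfies `y ^ d = a` by injectivity, and
    -- the exponent of `b` gives `d * χ y = 1`, so `d = ±1`. As `y` need not lie in `S`, the
    -- character `χ` is defined on all edges.
    have hfix : f.iter m a = a ∨ f.iter m a = a⁻¹ := by
      have h1 := f.joins_iter haj m
      rw [hm] at h1
      obtain ⟨d, hd⟩ := Subgroup.mem_zpowers_iff.1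
        (hmem' _ h1 (f.iter_mem_supportedIn hS haS m))
      obtain ⟨y, hy, hya⟩ := hf.exists_iter_eq hΓ (u := v) (k := m) (h := a) (by rwa [hm])
      have hyd : y ^ d * a⁻¹ = 1 := by
        refine hf.eq_one_of_iter hΓ (u := v) (k := m) ?_ ?_
        · refine Joins.mul ?_ haj.inv
          exact mem_fundamentalGroup.1 (Subgroup.zpow_mem _ (mem_fundamentalGroup.2 hy) d)
        · rw [map_mul, map_zpow, hya, map_inv, hd, mul_inv_cancel]
      let χ : FreeGroup E →* Multiplicative ℤ :=
        FreeGroup.lift fun e => if e = b then Multiplicative.ofAdd 1 else 1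
      have hχa : χ a = Multiplicative.ofAdd 1 := by
        rw [ha, hT.hom_retraction_of]
        · simp [χ]
        · intro e he
          have : e ≠ b := fun h => hbmem.2 (h ▸ he)
          simp [χ, this]
      have h2 : χ y ^ d = Multiplicative.ofAdd 1 := by
        rw [← hχa, ← map_zpow, mul_inv_eq_one.1 hyd]
      have h3 : d * (χ y).toAdd = 1 := by
        have := congrArg Multiplicative.toAdd h2
        simpa using this
      rcases Int.isUnit_iff.1 (IsUnit.of_mul_eq_one _ h3) with rfl | rfl
      · exact Or.inl (by rw [← hd, zpow_one])
      · exact Or.inr (by rw [← hd, zpow_neg_one])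
    have hfixk : f.iter (m * k) a = a ∨ f.iter (m * k) a = a⁻¹ := by
      induction k with
      | zero => exact Or.inl rfl
      | succ k ih =>
        rw [Nat.mul_succ, Nat.add_comm, iter_add]
        rcases ih with h | h <;> rw [h] <;> rcases hfix with h' | h' <;> simp [h']
    obtain ⟨z, rfl⟩ := Subgroup.mem_zpowers_iff.1 (hmem' c hc hcS)
    rcases hfixk with h | h
    · rw [map_zpow, h]
    · rw [map_zpow, h, inv_zpow, letterCount_inv]

/-- If the component of the fixed vertex `v` of the subgraph `S` has corank at most one, then the
number of edges outside `S` of the iterated images of the powers of a loop is bounded. -/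
theorem exists_letterCount_iter_le [Fintype E] (hf : f.Represents τ Φ) (hΓ : Γ.Connected)
    (hm : f.vert^[m] v = v) (hS : ∀ e ∈ S, ∀ d ∈ f.edge e, d.1 ∈ S)
    (hT : Γ.IsTreeAt v Set.univ T p) (hp : ∀ u, Γ.Reachable S v u → p u ∈ supportedIn S)
    (hrank : (Tᶜ \ Γ.component S v).ncard ≤ 1) {H : Set E} (hH : Disjoint H S)
    {x : FreeGroup E} (hx : Γ.Joins v v x) :
    ∃ W, ∀ k l, letterCount H (f.iter (m * k) (x ^ l)) ≤ l * W := by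
  classical
  set ρ := Γ.retraction p with hρ
  set C := Γ.component S v with hC
  have hCS : C ⊆ S := fun e he => he.1
  -- Generators coming from the component stay in it under `f ^ (m * k)`, so their derivatives with
  -- respect to outside edges vanish; only the term of `t` survives in the chain rule.
  have hzero : ∀ (k : ℕ) (b : E), b ∉ Tᶜ \ C → ∀ e ∉ C,
      FreeGroup.fox e (f.iter (m * k) (ρ (FreeGroup.of b))) = 0 := by
    intro k b hb e he
    by_cases hbT : b ∈ T
    · rw [hρ, hT.retraction_of_mem hbT, map_one, FreeGroup.fox_one]
    · have hbC : b ∈ C := by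
        by_contra hbC
        exact hb ⟨hbT, hbC⟩
      exact fox_eq_zero_of_mem_supportedIn he (mem_supportedIn_component
        (joins_iter_of_periodic hm (hT.joins_retraction_of b) k)
        (f.iter_mem_supportedIn hS (retraction_mem_supportedIn hp hbC) _))
  have hchain : ∀ (k : ℕ) (g : FreeGroup E) (e : E), FreeGroup.fox e (f.iter (m * k) (ρ g)) =
      ∑ b, MonoidAlgebra.mapDomainRingHom ℤ ((f.iter (m * k)).comp ρ) (FreeGroup.fox b g) *
        FreeGroup.fox e (f.iter (m * k) (ρ (FreeGroup.of b))) := fun k g e =>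
    FreeGroup.fox_map e ((f.iter (m * k)).comp ρ) g
  have hHC : ∀ e ∈ H, e ∉ C := fun e he heC => Set.disjoint_left.1 hH he (hCS heC)
  rcases (Set.ncard_le_one_iff_eq (Set.toFinite _)).1 hrank with h0 | ⟨t, ht⟩
  · refine ⟨0, fun k l => ?_⟩
    refine (letterCount_le_sum_fox H _).trans ?_
    rw [mul_zero, Nat.le_zero]
    refine Finset.sum_eq_zero fun e he => ?_
    rw [← hT.retraction_eq_self (hx.pow l), hchain, Finset.sum_eq_zero]
    · simp
    · intro b _
      rw [hzero k b (by simp [h0]) e (hHC e (Finset.mem_filter.1 he).2), mul_zero]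
  · have htmem : t ∈ Tᶜ \ C := by rw [ht]; rfl
    have hchain' : ∀ (k : ℕ) (g : FreeGroup E) (e : E), e ∉ C →
        FreeGroup.fox e (f.iter (m * k) (ρ g)) =
          MonoidAlgebra.mapDomainRingHom ℤ ((f.iter (m * k)).comp ρ) (FreeGroup.fox t g) *
            FreeGroup.fox e (f.iter (m * k) (ρ (FreeGroup.of t))) := by
      intro k g e he
      rw [hchain, Finset.sum_eq_single t]
      · intro b _ hbt
        rw [hzero k b (by rw [ht]; exact hbt) e he, mul_zero]
      · simp
    have hj := hT.joins_retraction_of t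
    -- The chain rule for a preimage `y` of the generator `ρ t`, followed by `ρ`, has left side `1`:
    -- the derivative of `ρ t` with respect to `t` is a tree path, which `ρ` kills. The right factor
    -- is thus a one-sided unit.
    have hunit : ∀ k, ∃ g r, MonoidAlgebra.mapDomainRingHom ℤ ρ
        (FreeGroup.fox t (f.iter (m * k) (ρ (FreeGroup.of t)))) = MonoidAlgebra.single g r := by
      intro k
      obtain ⟨y, hy, hyt⟩ := hf.exists_iter_eq hΓ (u := v) (k := m * k) (h := ρ (FreeGroup.of t))
        (by rw [Function.iterate_mul, Function.iterate_fixed hm]; exact hj)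
      have h1 := hchain' k y t htmem.2
      rw [hρ, hT.retraction_eq_self hy, ← hρ, hyt] at h1
      have h2 := congrArg (MonoidAlgebra.mapDomainRingHom ℤ ρ) h1
      rw [map_mul, hρ, hT.fox_retraction_of htmem.1, ← hρ] at h2
      refine MonoidAlgebra.exists_eq_single_of_mul_eq_one (h2.symm.trans ?_)
      rw [MonoidAlgebra.mapDomainRingHom_apply, MonoidAlgebra.mapDomain_single, hρ,
        hT.retraction_eq_one (hT.supp _ trivial)]
      rfl
    refine ⟨(FreeGroup.fox t x).coeff.support.card *
      ∑ e with e ∈ H, (FreeGroup.fox e (ρ (FreeGroup.of t))).coeff.support.card, fun k l => ?_⟩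
    refine (letterCount_le_sum_fox H _).trans ?_
    rw [← mul_assoc, Finset.mul_sum]
    refine Finset.sum_le_sum fun e he => ?_
    have heC := hHC e (Finset.mem_filter.1 he).2
    have h1 := hchain' k (x ^ l) e heC
    rw [hρ, hT.retraction_eq_self (hx.pow l), ← hρ] at h1
    -- With exponent `0`, the chain rule writes the derivative of the image of `ρ t` as a single
    -- term times that of `ρ t`; this makes the bound independent of `k`.
    have h2 := hchain' 0 (f.iter (m * k) (ρ (FreeGroup.of t))) e heC
    obtain ⟨g, r, hgr⟩ := hunit k
    have h3 : f.iter (m * 0) = MonoidHom.id _ := rfl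
    rw [h3, MonoidHom.id_comp, hgr] at h2
    simp only [MonoidHom.id_apply] at h2
    rw [hρ, hT.retraction_eq_self (joins_iter_of_periodic hm hj k), ← hρ] at h2
    rw [h1, h2]
    refine (MonoidAlgebra.card_support_mul_le _ _).trans (Nat.mul_le_mul ?_ ?_)
    · exact (MonoidAlgebra.card_support_mapDomain_le _ _).trans (card_support_fox_pow_le t x l)
    · exact (MonoidAlgebra.card_support_mul_le _ _).trans
        ((Nat.mul_le_mul_right _ (MonoidAlgebra.card_support_single_le _ _)).trans (one_mul _).le)

/-- A relative train track representative of an outer automorphism of a free group of rank three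
does not have two exponential strata. -/
theorem Filtration.not_isExponential_of_lt [Finite V] [Fintype E]
    {Φ : OuterAut (FreeGroup (Fin 3))} {τ : Γ.Marking 3} (hf : f.Represents τ Φ)
    (hΓ : Γ.Connected) {F : f.Filtration} (hF : F.IsRelativeTrainTrack) {i j : Fin F.len}
    (hij : i < j) (hi : F.IsExponential i) : ¬ F.IsExponential j := by
  classical
  intro hj
  obtain ⟨u₁, c₁, L₁, hc₁, hc₁S, hmono₁, hunb₁, hL₁⟩ := Filtration.exists_growing_loop hF hi
  obtain ⟨u₂, c₂, L₂, hc₂, -, hmono₂, hunb₂, hL₂⟩ := Filtration.exists_growing_loop hF hj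
  set S := F.sub j.castSucc with hSdef
  have hS := F.invariant j.castSucc
  have hc₁S' : c₁ ∈ supportedIn S :=
    supportedIn_mono (F.strictMono.monotone (Fin.succ_le_castSucc_iff.2 hij)) hc₁S
  -- An orbit of vertices in a finite graph is eventually periodic.
  obtain ⟨k₀, m, hmpos, hm⟩ : ∃ k₀ m, 0 < m ∧ f.vert^[m] (f.vert^[k₀] u₁) = f.vert^[k₀] u₁ := by
    obtain ⟨a, b, hab, heq⟩ :=
      Finite.exists_ne_map_eq_of_infinite fun k : ℕ => f.vert^[k] u₁
    wlog hlt : a < b generalizing a b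
    · exact this b a hab.symm heq.symm (lt_of_le_of_ne (not_lt.1 hlt) hab.symm)
    refine ⟨a, b - a, by lia, ?_⟩
    rw [← Function.iterate_add_apply, Nat.sub_add_cancel hlt.le]
    exact heq.symm
  set v := f.vert^[k₀] u₁ with hv
  obtain ⟨T, p, hT, hp⟩ := exists_spanningTree hΓ v S
  -- The two counts add up to at most `3`, so they cannot both be at least `2`.
  have hrank : (Γ.component S v \ T).ncard ≤ 1 ∨ (Tᶜ \ Γ.component S v).ncard ≤ 1 := by
    have h1 := hT.ncard_compl_le hΓ τ
    have h2 := Set.ncard_inter_add_ncard_sdiff_eq_ncard Tᶜ (Γ.component S v) (Set.toFinite _)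
    have h3 : Tᶜ ∩ Γ.component S v = Γ.component S v \ T := by
      rw [Set.inter_comm]; rfl
    rw [h3] at h2
    lia
  rcases hrank with hrank | hrank
  · have hc : Γ.Joins v v (f.iter k₀ c₁) := f.joins_iter hc₁ k₀
    obtain ⟨K, hK⟩ := hunb₁ (letterCount (F.stratum i) (f.iter k₀ c₁))
    have h1 := letterCount_iter_eq_of_cyclic hf hΓ hm hS hT hp hrank hc
      (f.iter_mem_supportedIn hS hc₁S' k₀) (F.stratum i) K
    rw [← iter_add] at h1
    have h2 := hL₁ (m * K + k₀) 1
    rw [one_mul, pow_one, h1] at h2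
    have h3 : K ≤ m * K + k₀ := (Nat.le_mul_of_pos_left K hmpos).trans (Nat.le_add_right _ _)
    exact absurd ((hK.trans_le (hmono₁ h3)).trans_le h2) (lt_irrefl _)
  · obtain ⟨q, hq⟩ := hΓ.exists_joins v u₂
    have hdisj : Disjoint (F.stratum j) S := Set.disjoint_left.2 fun e he heS => he.2 heS
    obtain ⟨W, hW⟩ := exists_letterCount_iter_le hf hΓ hm hS hT hp hrank hdisj
      ((hq.mul hc₂).mul hq.inv)
    obtain ⟨K, hK⟩ := hunb₂ W
    have hK' : W < L₂ (m * K) := hK.trans_le (hmono₂ (Nat.le_mul_of_pos_left K hmpos))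
    -- Moving the upper loop to `v` along `q` costs at most `2 * Q` letters. The power `2 * Q + 1`
    -- gains at least `2 * Q + 1` over the bound of slope `W`, which exceeds this cost.
    set Q := letterCount (F.stratum j) (f.iter (m * K) q) with hQ
    have h1 := hL₂ (m * K) (2 * Q + 1)
    have h2 := letterCount_le_conj (F.stratum j) (f.iter (m * K) q)
      (f.iter (m * K) c₂ ^ (2 * Q + 1))
    have h3 := hW K (2 * Q + 1)
    rw [conj_pow, map_mul, map_mul, map_inv, map_pow] at h3
    rw [← hQ] at h2
    have h4 : (2 * Q + 1) * (W + 1) ≤ (2 * Q + 1) * L₂ (m * K) := Nat.mul_le_mul_left _ hK'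
    rw [Nat.mul_succ] at h4
    lia

end EdgePathMap

end CellGraph

theorem proposition5p2 (Φ : OuterAut (FreeGroup (Fin 3)))
    {V E : Type*} [Fintype V] [Fintype E] (Γ : CellGraph V E) (hΓ : Γ.Connected)
    (τ : Γ.Marking 3) (f : Γ.EdgePathMap) (hf : f.Represents τ Φ)
    (F : f.Filtration) (hF : F.IsRelativeTrainTrack) :
    {i : Fin F.len | F.IsExponential i}.Subsingleton := by
  intro i hi j hj
  by_contra hne
  rcases lt_or_gt_of_ne hne with h | h
  · exact CellGraph.EdgePathMap.Filtration.not_isExponential_of_lt hf hΓ hF h hi hj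
  · exact CellGraph.EdgePathMap.Filtration.not_isExponential_of_lt hf hΓ hF h hj hi
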